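/- Let $n\ge 1$ be an integer and, for $t\ge 0$, let $$Z_{n,t}(x)=\sum_{\sigma\in\{-1,+1\}^n}\exp\Big[t\Big(\sum_{j=1}^n\sigma_j\Big)^2+ix\sum_{j=1}^n\sigma_j\Big],\qquad x\in\mathbb{C},$$ be the partition function of the Curie--Weiss model (the Ising model on the complete graph with $n$ vertices) with external field $ix$. Let $0<x_1(t)\le x_2(t)\le\cdots$ be the positive zeros of $Z_{n,t}$, listed according to multiplicity. For every $t\ge 0$ the first of them are the principal zeros: $0<x_1(t)\le\dots\le x_{\lfloor n/2\rfloor}(t)\le\pi/2$, and all complex zeros of $Z_{n,t}$, with multiplicity, are $\pm x_k(t)+m\pi$ with $1\le k\le\lfloor n/2\rfloor$, $m\in\mathbb{Z}$, together with $\pi/2+m\pi$, $m\in\mathbb{Z}$, if $n$ is odd. Moreover, for each $k\in\{1,\dots,\lfloor n/2\rfloor\}$, the function $x_k(t)$ is strictly decreasing in $t\ge 0$, with $$x_k(0)=\frac{\pi}{2},\qquad \lim_{t\to\infty}x_k(t)=\frac{(2k-1)\pi}{2n},$$ and if $n$ is odd, then $x_{(n+1)/2}(t)=\pi/2$ for all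 $t\ge 0$. -/

import Mathlib

open Set Filter Topology

namespace CurieWeiss

noncomputable section

/-- The Curie–Weiss partition function with imaginary external field `i x`:
the sum over `σ ∈ {-1, +1}ⁿ` of `exp (t (∑ σ_j)² + i x ∑ σ_j)`. -/
def partitionFunction (n : ℕ) (t : ℝ) (x : ℂ) : ℂ :=
  ∑ σ : Fin n → ℤˣ,
    Complex.exp ((t : ℂ) * (∑ j, ((σ j : ℤ) : ℂ)) ^ 2
      + Complex.I * x * ∑ j, ((σ j : ℤ) : ℂ))

/-- The number of real zeros of `Z_{n,t}` in `(0, y]`, counted with multiplicity.  (The function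
`Z_{n,t}` is entire and `Z_{n,t}(0) > 0`, so the sum has only finitely many nonzero terms,
all of them finite.) -/
def positiveZeroCount (n : ℕ) (t y : ℝ) : ℕ∞ :=
  ∑ᶠ u ∈ Ioc (0 : ℝ) y, analyticOrderAt (partitionFunction n t) (u : ℂ)

/-- `x_k(t)`: the `k`-th positive zero of `Z_{n,t}` (for `k = 1, 2, …`), where the positive zeros
`x_1(t) ≤ x_2(t) ≤ …` are listed in nondecreasing order and according to multiplicity. -/
def zero (n k : ℕ) (t : ℝ) : ℝ :=
  sInf {y : ℝ | 0 < y ∧ (k : ℕ∞) ≤ positiveZeroCount n t y}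

/-- How often the complex number `w` occurs in the family `ε a + m π`, `ε ∈ {1, -1}`, `m ∈ ℤ`. -/
def reflectedCount (a : ℝ) (w : ℂ) : ℕ∞ :=
  Set.encard {p : ℤˣ × ℤ | w = ((p.1 : ℤ) : ℂ) * (a : ℂ) + (p.2 : ℂ) * (Real.pi : ℂ)}

/-- How often the complex number `w` occurs in the family `a + m π`, `m ∈ ℤ`. -/
def translatedCount (a : ℝ) (w : ℂ) : ℕ∞ :=
  Set.encard {m : ℤ | w = (a : ℂ) + (m : ℂ) * (Real.pi : ℂ)}

/-- `x 1, …, x ⌊n/2⌋` are the principal zeros of `Z_{n,t}`: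
`0 < x 1 ≤ x 2 ≤ … ≤ x ⌊n/2⌋ ≤ π/2`, and all complex zeros of `Z_{n,t}`, with multiplicity, are
`± x k + m π` for `1 ≤ k ≤ ⌊n/2⌋`, `m ∈ ℤ`, together with `π/2 + m π`, `m ∈ ℤ`, if `n` is odd. -/
structure ArePrincipalZeros (n : ℕ) (t : ℝ) (x : ℕ → ℝ) : Prop where
  mem_Ioc : ∀ k ∈ Icc 1 (n / 2), x k ∈ Ioc 0 (Real.pi / 2)
  monotoneOn : MonotoneOn x (Icc 1 (n / 2))
  analyticOrderAt_eq : ∀ w : ℂ,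
    analyticOrderAt (partitionFunction n t) w =
      (∑ k ∈ Finset.Icc 1 (n / 2), reflectedCount (x k) w)
        + if n % 2 = 1 then translatedCount (Real.pi / 2) w else 0

end

end CurieWeiss

/-!
With `S = ∑ σ_j`, `e^{t S²}` is the limit of `cosh (S/√N) ^ ⌊2tN⌋`, and multiplying the coefficient of
`e^{iSx}` by `cosh (S δ)` replaces a function `f` by the average of `f (x + iδ)` and `f (x - iδ)`.
The partition function `Z_{n,t}` is therefore a limit of functions obtained from
`Z_{n,0} = (2 cos x)ⁿ` by repeated averaging.

One averaging step keeps all zeros real and preserves their order.  For real principal zeros `a k`, the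
function `f (x + iδ)` is, for real `x`, a nonzero real multiple of `e^{-iG(x)}`, where `G` is a sum of
strictly increasing phases, and the average is the real part.  Its zeros are thus the points with
`cos G(x) = 0`; as `G` increases from `0` to `nπ/2` on `[0, π/2]`, there are as many as the degree
allows (`expSum_eq_trigProd`).  Lowering the `a k` raises `G` on `[0, π/2]` (`totalPhase_anti`, which
rests on the Poisson kernel being monotone in the distance), and so lowers the new zeros.  Since the
process starts with all principal zeros at the maximum `π/2`, the zeros decrease from step to step
(`exists_iterated_factorization`), and by compactness this passes to the limit
(`exists_ordered_factorizations`).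

The decrease is strict: a zero constant on a time interval would be a zero for all times, by
analyticity in `t`, which contradicts the behaviour of `Z_{n,t}` as `t → -∞`.  As `t → ∞` the function
`e^{-tn²} Z_{n,t}` converges to `2 cos (nx)`, whose principal zeros are `(2k - 1)π / (2n)`.
-/

namespace CurieWeiss

/-! ### Exponential sums and their factorization -/

/-- The exponential sum `∑ c_k e^{i (n - 2k) x}` over `0 ≤ k ≤ n`, with real coefficients. -/
noncomputable def expSum (n : ℕ) (c : ℕ → ℝ) (x : ℂ) : ℂ :=
  ∑ k ∈ Finset.range (n + 1), (c k : ℂ) * Complex.exp (Complex.I * x * ((n : ℂ) - 2 * k))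

/-- The even trigonometric polynomial of degree `n` with principal zeros `a 1, …, a ⌊n/2⌋`: its zeros
are `± a k + mπ`, together with `π/2 + mπ` for odd `n`, and its coefficient of `e^{inx}` is
one.  Only the values of `a` on `{1, …, ⌊n/2⌋}` matter. -/
noncomputable def trigProd (n : ℕ) (a : ℕ → ℝ) (x : ℂ) : ℂ :=
  (2 * Complex.cos x) ^ (n % 2) *
    ∏ k ∈ Finset.Icc 1 (n / 2), (2 * Complex.cos (2 * x) - 2 * Complex.cos (2 * (a k : ℂ)))

/-- The coefficient of `e^{i (n - 2k) x}` in `Z_{n,t}(x)`, from the configurations with `k` spins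
`-1`. -/
noncomputable def isingCoeff (n : ℕ) (t : ℝ) (k : ℕ) : ℝ :=
  n.choose k * Real.exp (t * ((n : ℝ) - 2 * k) ^ 2)

theorem sum_signs (n : ℕ) (g : ℤ → ℂ) :
    ∑ σ : Fin n → ℤˣ, g (∑ j, ((σ j : ℤˣ) : ℤ)) =
      ∑ k ∈ Finset.range (n + 1), (n.choose k : ℂ) * g ((n : ℤ) - 2 * k) := by
  induction n generalizing g with
  | zero => simp
  | succ n ih =>
    rw [← (Fin.consEquiv (fun _ => ℤˣ)).sum_comp, Fintype.sum_prod_type]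
    have hU : (Finset.univ : Finset ℤˣ) = {1, -1} := rfl
    simp only [Fin.consEquiv_apply, Fin.sum_univ_succ, Fin.cons_zero, Fin.cons_succ]
    rw [hU, Finset.sum_pair (by decide)]
    rw [ih (fun s => g ((((1 : ℤˣ) : ℤ)) + s)), ih (fun s => g ((((-1 : ℤˣ) : ℤ)) + s)),
      Finset.sum_choose_succ_mul (fun k _ => g (((n + 1 : ℕ) : ℤ) - 2 * k))]
    congr 1
    · refine Finset.sum_congr rfl fun k _ => ?_
      congr 2
      push_cast
      ring
    · refine Finset.sum_congr rfl fun k _ => ?_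
      congr 2
      push_cast
      ring

theorem partitionFunction_eq_expSum (n : ℕ) (t : ℝ) :
    partitionFunction n t = expSum n (isingCoeff n t) := by
  funext x
  have := sum_signs n (fun s => Complex.exp ((t : ℂ) * (s : ℂ) ^ 2 + Complex.I * x * s))
  simp only [Int.cast_sum] at this
  rw [partitionFunction, this, expSum]
  refine Finset.sum_congr rfl fun k _ => ?_
  simp only [isingCoeff]
  push_cast
  rw [Complex.exp_add]
  ring

/-- At `t = 0` the partition function is `(2 cos x)ⁿ`, all of whose zeros are at `π/2 + mπ`. -/
theorem expSum_choose (n : ℕ) (x : ℂ) :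
    expSum n (fun k => n.choose k) x = trigProd n (fun _ => Real.pi / 2) x := by
  have h1 : trigProd n (fun _ => Real.pi / 2) x = (2 * Complex.cos x) ^ n := by
    have h2 : Complex.cos (2 * ((Real.pi / 2 : ℝ) : ℂ)) = -1 := by
      push_cast
      rw [mul_div_cancel₀ _ two_ne_zero, Complex.cos_pi]
    have h3 : 2 * Complex.cos (2 * x) - 2 * (-1) = (2 * Complex.cos x) ^ 2 := by
      rw [Complex.cos_two_mul]
      ring
    simp only [trigProd, h2, h3, Finset.prod_const, Nat.card_Icc, Nat.add_sub_cancel]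
    rw [← pow_mul, ← pow_add, Nat.mod_add_div]
  rw [h1, Complex.two_cos, add_comm, add_pow, expSum]
  refine Finset.sum_congr rfl fun k hk => ?_
  have hk' : k ≤ n := Nat.lt_succ_iff.mp (Finset.mem_range.mp hk)
  rw [← Complex.exp_nat_mul, ← Complex.exp_nat_mul, ← Complex.exp_add, Nat.cast_sub hk']
  push_cast
  rw [mul_comm]
  congr 2
  ring

open Polynomial in
/-- An exponential sum is determined up to its leading coefficient by `n` distinct zeros modulo `π`.
In the variable `z = e^{2ix}` it is a polynomial of degree at most `n`, divisible by the pairwise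
coprime factors `z² - 2 cos (2 b_k) z + 1` and, for odd `n`, `z + 1`. -/
theorem expSum_eq_trigProd {n : ℕ} {c : ℕ → ℝ} {b : ℕ → ℝ}
    (hb : ∀ k ∈ Icc 1 (n / 2), b k ∈ Ioo 0 (Real.pi / 2)) (hmono : StrictMonoOn b (Icc 1 (n / 2)))
    (h0 : ∀ k ∈ Icc 1 (n / 2), expSum n c (b k) = 0)
    (h0' : ∀ k ∈ Icc 1 (n / 2), expSum n c (-b k) = 0)
    (hodd : n % 2 = 1 → expSum n c ((Real.pi / 2 : ℝ) : ℂ) = 0) (x : ℂ) :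
    expSum n c x = c 0 * trigProd n b x := by
  set P : ℂ[X] := ∑ k ∈ Finset.range (n + 1), C (c k : ℂ) * X ^ (n - k) with hP
  set q : ℕ → ℂ[X] := fun k => X ^ 2 - C (2 * Complex.cos (2 * (b k : ℂ))) * X + 1 with hq
  set Q : ℂ[X] := (X + 1) ^ (n % 2) * ∏ k ∈ Finset.Icc 1 (n / 2), q k with hQ
  have hexp (y : ℂ) : P.eval (Complex.exp (2 * Complex.I * y)) =
      Complex.exp (Complex.I * y * n) * expSum n c y := by
    simp only [hP, expSum, eval_finsetSum, Finset.mul_sum, eval_mul, eval_C, eval_pow, eval_X]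
    refine Finset.sum_congr rfl fun k hk => ?_
    have hk' : k ≤ n := Nat.lt_succ_iff.mp (Finset.mem_range.mp hk)
    rw [mul_left_comm, ← Complex.exp_add, ← Complex.exp_nat_mul, Nat.cast_sub hk']
    congr 2
    ring
  have hqexp (k : ℕ) (y : ℂ) : (q k).eval (Complex.exp (2 * Complex.I * y)) =
      Complex.exp (Complex.I * y * 2) *
        (2 * Complex.cos (2 * y) - 2 * Complex.cos (2 * (b k : ℂ))) := by
    simp only [hq, eval_add, eval_sub, eval_pow, eval_X, eval_mul, eval_C, eval_one]
    rw [Complex.two_cos (2 * y)]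
    have e1 : Complex.exp (Complex.I * y * 2) = Complex.exp (2 * y * Complex.I) := by ring_nf
    have e2 : Complex.exp (2 * Complex.I * y) = Complex.exp (2 * y * Complex.I) := by ring_nf
    have e3 : Complex.exp (2 * y * Complex.I) * Complex.exp (-(2 * y) * Complex.I) = 1 := by
      rw [← Complex.exp_add]
      simp
    rw [e1, e2]
    linear_combination -e3
  have hQexp (y : ℂ) : Q.eval (Complex.exp (2 * Complex.I * y)) =
      Complex.exp (Complex.I * y * n) * trigProd n b y := by
    have h1 : (X + 1 : ℂ[X]).eval (Complex.exp (2 * Complex.I * y)) =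
        Complex.exp (Complex.I * y) * (2 * Complex.cos y) := by
      rw [Complex.two_cos, mul_add, ← Complex.exp_add, ← Complex.exp_add]
      simp only [eval_add, eval_X, eval_one]
      congr 1
      · congr 1
        ring
      · rw [show Complex.I * y + -y * Complex.I = 0 by ring, Complex.exp_zero]
    simp only [hQ, eval_mul, eval_pow, h1, eval_prod, hqexp, Finset.prod_mul_distrib,
      Finset.prod_const, Nat.card_Icc, Nat.add_sub_cancel, trigProd, mul_pow]
    rw [← Complex.exp_nat_mul, ← Complex.exp_nat_mul]
    have h2 : Complex.exp (Complex.I * y * n) =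
        Complex.exp (((n % 2 : ℕ) : ℂ) * (Complex.I * y)) *
          Complex.exp (((n / 2 : ℕ) : ℂ) * (Complex.I * y * 2)) := by
      rw [← Complex.exp_add]
      congr 1
      have := congrArg (Nat.cast (R := ℂ)) (Nat.mod_add_div n 2)
      push_cast at this ⊢
      rw [← this]
      ring
    rw [h2]
    ring
  have hqm (k : ℕ) : (q k).Monic := by
    simp only [hq]
    monicity!
  have hqd (k : ℕ) : (q k).natDegree = 2 := by
    simp only [hq]
    compute_degree!
  have hQm : Q.Monic :=
    ((monic_X_add_C (1 : ℂ)).pow _).mul (monic_prod_of_monic _ _ fun k _ => hqm k)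
  have hQd : Q.natDegree = n := by
    rw [hQ, Monic.natDegree_mul (by simpa using (monic_X_add_C (1 : ℂ)).pow _)
      (monic_prod_of_monic _ _ fun k _ => hqm k), natDegree_prod_of_monic _ _ fun k _ => hqm k]
    have : (X + 1 : ℂ[X]).natDegree = 1 := by simpa using natDegree_X_add_C (1 : ℂ)
    simp only [hqd, Finset.sum_const, Nat.card_Icc, natDegree_pow, this]
    have := Nat.mod_add_div n 2
    simp only [Nat.add_sub_cancel, smul_eq_mul]
    lia
  have hcos : ∀ k ∈ Icc 1 (n / 2), ∀ l ∈ Icc 1 (n / 2), k ≠ l →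
      Complex.cos (2 * (b k : ℂ)) ≠ Complex.cos (2 * (b l : ℂ)) := by
    intro k hk l hl hkl h
    have h1 : Real.cos (2 * b k) = Real.cos (2 * b l) := by exact_mod_cast h
    have h2 := Real.injOn_cos (by constructor <;> linarith [(hb k hk).1, (hb k hk).2])
      (by constructor <;> linarith [(hb l hl).1, (hb l hl).2]) h1
    exact hkl (hmono.injOn hk hl (by linarith))
  have hcos' : ∀ k ∈ Icc 1 (n / 2), Complex.cos (2 * (b k : ℂ)) ≠ -1 := by
    intro k hk h
    have h1 : Real.cos (2 * b k) = Real.cos Real.pi := by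
      rw [Real.cos_pi]
      exact_mod_cast h
    have h2 := Real.injOn_cos (by constructor <;> linarith [(hb k hk).1, (hb k hk).2])
      (by constructor <;> linarith [Real.pi_pos]) h1
    linarith [(hb k hk).2]
  have hcop : ∀ k ∈ Icc 1 (n / 2), ∀ l ∈ Icc 1 (n / 2), k ≠ l → IsCoprime (q k) (q l) := by
    intro k hk l hl hkl
    have hne : 2 * Complex.cos (2 * (b l : ℂ)) - 2 * Complex.cos (2 * (b k : ℂ)) ≠ 0 := by
      rw [← mul_sub]
      exact mul_ne_zero two_ne_zero (sub_ne_zero.mpr (hcos k hk l hl hkl).symm)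
    set u := 2 * Complex.cos (2 * (b l : ℂ)) - 2 * Complex.cos (2 * (b k : ℂ)) with hu
    -- `q k - q l = u X`, and `1 = q l - X (X - 2 cos)`.
    refine ⟨-(C u⁻¹ * (X - C (2 * Complex.cos (2 * (b l : ℂ))))),
      1 + C u⁻¹ * (X - C (2 * Complex.cos (2 * (b l : ℂ)))), ?_⟩
    have hd : q k - q l = C u * X := by
      simp only [hq, hu, C_sub]
      ring
    have hi : (C u⁻¹ : ℂ[X]) * C u = 1 := by rw [← C_mul, inv_mul_cancel₀ hne, C_1]
    have hl' : q l = X * (X - C (2 * Complex.cos (2 * (b l : ℂ)))) + 1 := by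
      simp only [hq]
      ring
    linear_combination (-(C u⁻¹ * (X - C (2 * Complex.cos (2 * (b l : ℂ)))))) * hd + hl' -
      X * (X - C (2 * Complex.cos (2 * (b l : ℂ)))) * hi
  have hcop' : ∀ k ∈ Icc 1 (n / 2), IsCoprime (X + 1 : ℂ[X]) (q k) := by
    intro k hk
    have hne : 2 + 2 * Complex.cos (2 * (b k : ℂ)) ≠ 0 := by
      intro h
      exact hcos' k hk (by linear_combination h / 2)
    set u := 2 + 2 * Complex.cos (2 * (b k : ℂ)) with hu
    refine ⟨-(C u⁻¹ * (X + 1 - C u)), C u⁻¹, ?_⟩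
    have hi : (C u⁻¹ : ℂ[X]) * C u = 1 := by rw [← C_mul, inv_mul_cancel₀ hne, C_1]
    have hq' : q k = (X + 1) * (X + 1 - C u) + C u := by
      simp only [hq, hu, C_add, C_ofNat]
      ring
    linear_combination C u⁻¹ * hq' + hi
  have hqP : ∀ k ∈ Icc 1 (n / 2), q k ∣ P := by
    intro k hk
    have hr (z : ℂ) (hz : expSum n c z = 0) : X - C (Complex.exp (2 * Complex.I * z)) ∣ P := by
      rw [dvd_iff_isRoot, IsRoot.def, hexp, hz, mul_zero]
    have hfac : q k = (X - C (Complex.exp (2 * Complex.I * b k))) *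
        (X - C (Complex.exp (2 * Complex.I * (-b k)))) := by
      have e1 : C (Complex.exp (2 * Complex.I * b k)) * C (Complex.exp (2 * Complex.I * (-b k))) =
          (1 : ℂ[X]) := by
        rw [← C_mul, ← Complex.exp_add]
        simp
      have e2 : C (Complex.exp (2 * Complex.I * b k)) + C (Complex.exp (2 * Complex.I * (-b k))) =
          C (2 * Complex.cos (2 * (b k : ℂ))) := by
        rw [← C_add, Complex.two_cos]
        congr 3 <;> ring
      simp only [hq]
      linear_combination -e1 + X * e2
    rw [hfac]
    refine IsCoprime.mul_dvd ?_ (hr _ (h0 k hk)) (hr _ (h0' k hk))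
    refine isCoprime_X_sub_C_of_isUnit_sub (IsUnit.mk0 _ ?_)
    have hs : Complex.exp (2 * Complex.I * b k) - Complex.exp (2 * Complex.I * (-b k)) =
        2 * Complex.I * ((Real.sin (2 * b k) : ℝ) : ℂ) := by
      push_cast
      rw [Complex.sin]
      have e1 : Complex.exp (2 * Complex.I * b k) = Complex.exp (2 * b k * Complex.I) := by ring_nf
      have e2 : Complex.exp (2 * Complex.I * -b k) = Complex.exp (-(2 * b k) * Complex.I) := by
        ring_nf
      rw [e1, e2]
      linear_combination (Complex.exp (2 * b k * Complex.I) -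
        Complex.exp (-(2 * b k) * Complex.I)) * Complex.I_sq
    rw [hs]
    have : 0 < Real.sin (2 * b k) := Real.sin_pos_of_pos_of_lt_pi
      (by linarith [(hb k hk).1]) (by linarith [(hb k hk).2])
    exact mul_ne_zero (mul_ne_zero two_ne_zero Complex.I_ne_zero) (by exact_mod_cast this.ne')
  have hQP : Q ∣ P := by
    refine IsCoprime.mul_dvd ?_ ?_ ?_
    · exact (IsCoprime.prod_right fun k hk => hcop' k (by simpa using hk)).pow_left
    · rcases Nat.mod_two_eq_zero_or_one n with h | h
      · rw [h, pow_zero]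
        exact one_dvd _
      · rw [h, pow_one, show (X + 1 : ℂ[X]) = X - C (-1) by simp, dvd_iff_isRoot, IsRoot.def]
        have e : Complex.exp (2 * Complex.I * ((Real.pi / 2 : ℝ) : ℂ)) = -1 := by
          rw [← Complex.exp_pi_mul_I]
          push_cast
          ring_nf
        rw [← e, hexp, hodd h, mul_zero]
    · exact Finset.prod_dvd_of_coprime
        (fun k hk l hl hkl => hcop k (by simpa using hk) l (by simpa using hl) hkl)
        (fun k hk => hqP k (by simpa using hk))
  have hPQ : P = C (c 0 : ℂ) * Q := by
    rw [← sub_eq_zero]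
    -- `Q` divides `P - c₀ Q`, whose degree is smaller because the top coefficients cancel.
    refine eq_zero_of_dvd_of_degree_lt (dvd_sub hQP (dvd_mul_left _ _)) ?_
    rw [degree_eq_natDegree hQm.ne_zero, hQd, degree_lt_iff_coeff_zero]
    intro j hj
    have hPc : P.coeff j = if j = n then (c 0 : ℂ) else 0 := by
      simp only [hP, finsetSum_coeff, coeff_C_mul, coeff_X_pow]
      rw [Finset.sum_eq_single 0]
      · simp
      · intro k hk hk0
        rw [if_neg, mul_zero]
        have := Finset.mem_range.mp hk
        lia
      · simp
    rw [coeff_sub, coeff_C_mul, hPc]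
    rcases hj.eq_or_lt with rfl | hj
    · rw [if_pos rfl]
      have : Q.coeff n = 1 := by
        have := hQm.coeff_natDegree
        rwa [hQd] at this
      rw [this, mul_one, sub_self]
    · rw [if_neg hj.ne', coeff_eq_zero_of_natDegree_lt (by rwa [hQd]), mul_zero, sub_zero]
  have h1 := hexp x
  rw [hPQ, eval_mul, eval_C, hQexp] at h1
  refine mul_left_cancel₀ (Complex.exp_ne_zero (Complex.I * x * n)) ?_
  linear_combination -h1

/-! ### The phase of `sin` on a horizontal line -/

/-- The continuous phase `h(u) = u - arg (1 - r e^{2iu})`, for `0 < r < 1`.  With `r = e^{-2δ}` it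
describes the argument of `sin` on the line `Im = δ`: `sin (u + iδ)` is a positive multiple of
`i e^{-i h(u)}`. -/
noncomputable def phase (r u : ℝ) : ℝ :=
  u + Real.arctan (r * Real.sin (2 * u) / (1 - r * Real.cos (2 * u)))

theorem one_sub_mul_cos_pos {r : ℝ} (hr : r ∈ Ioo (0 : ℝ) 1) (v : ℝ) : 0 < 1 - r * Real.cos v := by
  nlinarith [Real.cos_le_one v, hr.1, hr.2]

theorem poisson_denom_pos {r : ℝ} (hr : r ∈ Ioo (0 : ℝ) 1) (v : ℝ) :
    0 < 1 - 2 * r * Real.cos v + r ^ 2 := by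
  nlinarith [Real.cos_le_one v, hr.1, hr.2, sq_nonneg (1 - r)]

/-- The derivative of the phase is the Poisson kernel at angle `2u`. -/
theorem hasDerivAt_phase {r : ℝ} (hr : r ∈ Ioo (0 : ℝ) 1) (u : ℝ) :
    HasDerivAt (phase r) ((1 - r ^ 2) / (1 - 2 * r * Real.cos (2 * u) + r ^ 2)) u := by
  have hD := one_sub_mul_cos_pos hr (2 * u)
  have hE := poisson_denom_pos hr (2 * u)
  have hl : HasDerivAt (fun u : ℝ => 2 * u) 2 u := by simpa using (hasDerivAt_id u).const_mul 2
  have h : HasDerivAt (phase r) _ u := (hasDerivAt_id u).add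
    (((hl.sin.const_mul r).div ((hl.cos.const_mul r).const_sub 1) hD.ne').arctan)
  convert h using 1
  have hs := Real.sin_sq_add_cos_sq (2 * u)
  have hE' : (1 - r * Real.cos (2 * u)) ^ 2 + (r * Real.sin (2 * u)) ^ 2 =
      1 - 2 * r * Real.cos (2 * u) + r ^ 2 := by linear_combination r ^ 2 * hs
  have h1 : 1 + (r * Real.sin (2 * u) / (1 - r * Real.cos (2 * u))) ^ 2 =
      (1 - 2 * r * Real.cos (2 * u) + r ^ 2) / (1 - r * Real.cos (2 * u)) ^ 2 := by
    rw [← hE']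
    field_simp
  simp only [Pi.div_apply]
  rw [h1]
  obtain ⟨E, hE1⟩ : ∃ E, E = 1 - 2 * r * Real.cos (2 * u) + r ^ 2 := ⟨_, rfl⟩
  rw [← hE1] at hE ⊢
  have hE0 := hE.ne'
  field_simp
  rw [hE1]
  linear_combination (2 * r ^ 2) * hs

theorem strictMono_phase {r : ℝ} (hr : r ∈ Ioo (0 : ℝ) 1) : StrictMono (phase r) := by
  refine strictMono_of_hasDerivAt_pos (fun u => hasDerivAt_phase hr u) fun u => ?_
  exact div_pos (by nlinarith [hr.1, hr.2]) (poisson_denom_pos hr _)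

theorem continuous_phase {r : ℝ} (hr : r ∈ Ioo (0 : ℝ) 1) : Continuous (phase r) :=
  continuous_iff_continuousAt.mpr fun u => (hasDerivAt_phase hr u).continuousAt

theorem phase_neg (r u : ℝ) : phase r (-u) = -phase r u := by
  simp only [phase, mul_neg, Real.sin_neg, Real.cos_neg, neg_div, Real.arctan_neg]
  ring

theorem phase_add_pi (r u : ℝ) : phase r (u + Real.pi) = phase r u + Real.pi := by
  simp only [phase, mul_add, Real.sin_add_two_pi, Real.cos_add_two_pi]
  ring

theorem phase_pi_div_two (r : ℝ) : phase r (Real.pi / 2) = Real.pi / 2 := by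
  simp [phase, mul_div_cancel₀]

/-- Moving a symmetric pair of zeros `± y` away from the origin decreases the phase that it contributes
on `[0, π/2]`.  This holds as the Poisson kernel at `2(x + y)` is at most that at `2(x - y)`, by
`cos 2(x - y) - cos 2(x + y) = 2 sin 2x sin 2y ≥ 0`. -/
theorem antitoneOn_phase_pair {r : ℝ} (hr : r ∈ Ioo (0 : ℝ) 1) {x : ℝ}
    (hx : x ∈ Icc 0 (Real.pi / 2)) :
    AntitoneOn (fun y => phase r (x - y) + phase r (x + y)) (Icc 0 (Real.pi / 2)) := by
  have hder (y : ℝ) := ((hasDerivAt_phase hr (x - y)).comp y ((hasDerivAt_id y).const_sub x)).add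
    ((hasDerivAt_phase hr (x + y)).comp y ((hasDerivAt_id y).const_add x))
  refine antitoneOn_of_hasDerivWithinAt_nonpos (convex_Icc _ _)
    (fun y _ => (hder y).continuousAt.continuousWithinAt)
    (fun y _ => (hder y).hasDerivWithinAt) fun y hy => ?_
  rw [interior_Icc] at hy
  have h1 : Real.cos (2 * (x + y)) ≤ Real.cos (2 * (x - y)) := by
    rw [mul_add, mul_sub, Real.cos_add, Real.cos_sub]
    have := mul_nonneg
      (Real.sin_nonneg_of_nonneg_of_le_pi (x := 2 * x) (by linarith [hx.1]) (by linarith [hx.2]))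
      (Real.sin_nonneg_of_nonneg_of_le_pi (x := 2 * y) (by linarith [hy.1]) (by linarith [hy.2]))
    linarith
  have h2 : (1 - r ^ 2) / (1 - 2 * r * Real.cos (2 * (x + y)) + r ^ 2) ≤
      (1 - r ^ 2) / (1 - 2 * r * Real.cos (2 * (x - y)) + r ^ 2) := by
    have : 0 ≤ 1 - r ^ 2 := by nlinarith [hr.1, hr.2]
    refine div_le_div_of_nonneg_left this (poisson_denom_pos hr _) ?_
    nlinarith [hr.1]
  linarith

theorem sin_add_mul_I_eq {δ : ℝ} (hδ : 0 < δ) (u : ℝ) :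
    ∃ ρ : ℝ, 0 < ρ ∧ Complex.sin (u + δ * Complex.I) =
      ρ * (Complex.I * Complex.exp (-(Complex.I * (phase (Real.exp (-(2 * δ))) u : ℝ)))) := by
  set r := Real.exp (-(2 * δ)) with hr
  have hr1 : r ∈ Ioo (0 : ℝ) 1 := ⟨Real.exp_pos _, by rw [Real.exp_lt_one_iff]; linarith⟩
  have hD := one_sub_mul_cos_pos hr1 (2 * u)
  set α := Real.arctan (r * Real.sin (2 * u) / (1 - r * Real.cos (2 * u))) with hα
  have hc : 0 < Real.cos α := Real.cos_arctan_pos _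
  refine ⟨Real.exp δ / 2 * ((1 - r * Real.cos (2 * u)) / Real.cos α), by positivity, ?_⟩
  -- `1 - r e^{2iu}` has modulus `(1 - r cos 2u) / cos α` and argument `-α`.
  have hs : (1 - r * Real.cos (2 * u)) * Real.sin α = r * Real.sin (2 * u) * Real.cos α := by
    have := Real.tan_arctan (r * Real.sin (2 * u) / (1 - r * Real.cos (2 * u)))
    rw [← hα, Real.tan_eq_sin_div_cos] at this
    field_simp at this
    linarith
  have hone : (1 : ℂ) - r * Complex.exp (2 * u * Complex.I) =
      ((1 - r * Real.cos (2 * u)) / Real.cos α : ℝ) * Complex.exp (-(α * Complex.I)) := by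
    have e1 : Complex.exp (2 * u * Complex.I) =
        (Real.cos (2 * u) : ℝ) + (Real.sin (2 * u) : ℝ) * Complex.I := by
      rw [Complex.exp_mul_I]; push_cast; rfl
    have e2 : Complex.exp (-(α * Complex.I)) =
        (Real.cos α : ℝ) - (Real.sin α : ℝ) * Complex.I := by
      rw [← neg_mul, Complex.exp_mul_I, Complex.cos_neg, Complex.sin_neg]; push_cast; ring
    rw [e1, e2]
    have hs' : ((1 - r * Real.cos (2 * u)) / Real.cos α) * Real.sin α =
        r * Real.sin (2 * u) := by
      field_simp
      linarith
    have hc' : ((1 - r * Real.cos (2 * u)) / Real.cos α) * Real.cos α =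
        1 - r * Real.cos (2 * u) := by
      field_simp
    have hs'' := congrArg (fun y : ℝ => (y : ℂ)) hs'
    have hc'' := congrArg (fun y : ℝ => (y : ℂ)) hc'
    simp only [Complex.ofReal_mul, Complex.ofReal_sub, Complex.ofReal_one] at hs'' hc''
    linear_combination Complex.I * hs'' - hc''
  have hsin : Complex.sin (u + δ * Complex.I) = (Real.exp δ / 2 : ℝ) * (Complex.I *
      Complex.exp (-(u * Complex.I)) * (1 - r * Complex.exp (2 * u * Complex.I))) := by
    have e1 : Complex.exp ((u + δ * Complex.I) * Complex.I) =
        Complex.exp δ * Complex.exp (-(u * Complex.I)) * (r * Complex.exp (2 * u * Complex.I)) := by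
      rw [hr, Complex.ofReal_exp, ← Complex.exp_add, ← Complex.exp_add, ← Complex.exp_add]
      congr 1
      push_cast
      linear_combination (δ : ℂ) * Complex.I_sq
    have e2 : Complex.exp (-(u + δ * Complex.I) * Complex.I) =
        Complex.exp δ * Complex.exp (-(u * Complex.I)) := by
      rw [← Complex.exp_add]
      congr 1
      linear_combination (-δ : ℂ) * Complex.I_sq
    rw [Complex.sin, e1, e2]
    push_cast
    ring
  have hph : Complex.exp (-(Complex.I * (phase r u : ℝ))) =
      Complex.exp (-(u * Complex.I)) * Complex.exp (-(α * Complex.I)) := by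
    rw [← Complex.exp_add, phase, ← hα]
    congr 1
    push_cast
    ring
  rw [hsin, hone, hph]
  push_cast
  ring

/-! ### Averages over vertical shifts -/

/-- The phase of `trigProd n a` on the line `Im = δ`, where `r = e^{-2δ}`, normalized to vanish at the
origin: `trigProd n a (x + iδ)` is a positive multiple of `e^{-i totalPhase n r a x}`. -/
noncomputable def totalPhase (n : ℕ) (r : ℝ) (a : ℕ → ℝ) (x : ℝ) : ℝ :=
  ∑ k ∈ Finset.Icc 1 (n / 2), (phase r (x - a k) + phase r (x + a k)) +
    ((n % 2 : ℕ) : ℝ) * (phase r (x + Real.pi / 2) - Real.pi / 2)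

theorem totalPhase_zero (n : ℕ) (r : ℝ) (a : ℕ → ℝ) : totalPhase n r a 0 = 0 := by
  simp [totalPhase, phase_neg, phase_pi_div_two]

theorem totalPhase_pi_div_two (n : ℕ) (r : ℝ) (a : ℕ → ℝ) :
    totalPhase n r a (Real.pi / 2) = n * Real.pi / 2 := by
  have h (y : ℝ) : phase r (Real.pi / 2 - y) + phase r (Real.pi / 2 + y) = Real.pi := by
    rw [show Real.pi / 2 + y = -(Real.pi / 2 - y) + Real.pi by ring, phase_add_pi, phase_neg]
    ring
  have h2 : phase r (Real.pi / 2 + Real.pi / 2) = Real.pi := by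
    rw [show Real.pi / 2 + Real.pi / 2 = 0 + Real.pi by ring, phase_add_pi]
    simp [phase]
  simp only [totalPhase, h, h2, Finset.sum_const, Nat.card_Icc, Nat.add_sub_cancel, nsmul_eq_mul]
  have := congrArg (Nat.cast (R := ℝ)) (Nat.mod_add_div n 2)
  push_cast at this ⊢
  rw [← this]
  ring

theorem continuous_totalPhase (n : ℕ) {r : ℝ} (hr : r ∈ Ioo (0 : ℝ) 1) (a : ℕ → ℝ) :
    Continuous (totalPhase n r a) := by
  have := continuous_phase hr
  unfold totalPhase
  fun_prop

theorem strictMono_totalPhase {n : ℕ} (hn : 0 < n) {r : ℝ} (hr : r ∈ Ioo (0 : ℝ) 1) (a : ℕ → ℝ) :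
    StrictMono (totalPhase n r a) := by
  intro x y hxy
  have h := strictMono_phase hr
  have h1 : ∀ k ∈ Finset.Icc 1 (n / 2), phase r (x - a k) + phase r (x + a k) <
      phase r (y - a k) + phase r (y + a k) := fun k _ =>
    add_lt_add (h (by linarith)) (h (by linarith))
  have h2 : phase r (x + Real.pi / 2) < phase r (y + Real.pi / 2) := h (by linarith)
  unfold totalPhase
  rcases Nat.mod_two_eq_zero_or_one n with hm | hm
  · have : (Finset.Icc 1 (n / 2)).Nonempty := Finset.nonempty_Icc.mpr (by lia)
    have := Finset.sum_lt_sum_of_nonempty this h1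
    simpa [hm] using this
  · have := Finset.sum_le_sum fun k hk => (h1 k hk).le
    rw [hm]
    push_cast
    linarith

theorem totalPhase_anti {n : ℕ} {r : ℝ} (hr : r ∈ Ioo (0 : ℝ) 1) {a a' : ℕ → ℝ}
    (ha : ∀ k, a k ∈ Icc 0 (Real.pi / 2)) (ha' : ∀ k, a' k ∈ Icc 0 (Real.pi / 2)) (h : a' ≤ a)
    {x : ℝ} (hx : x ∈ Icc 0 (Real.pi / 2)) : totalPhase n r a x ≤ totalPhase n r a' x := by
  unfold totalPhase
  have := Finset.sum_le_sum fun k (_ : k ∈ Finset.Icc 1 (n / 2)) =>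
    antitoneOn_phase_pair hr hx (ha' k) (ha k) (h k)
  simp only at this
  linarith

theorem trigProd_add_mul_I (n : ℕ) {δ : ℝ} (hδ : 0 < δ) (a : ℕ → ℝ) (x : ℝ) :
    ∃ R : ℝ, 0 < R ∧ trigProd n a (x + δ * Complex.I) =
      R * Complex.exp (-(Complex.I * (totalPhase n (Real.exp (-(2 * δ))) a x : ℝ))) := by
  set r := Real.exp (-(2 * δ)) with hr
  choose ρ hρ hsin using fun u => sin_add_mul_I_eq hδ u
  rw [← hr] at hsin
  refine ⟨(2 * ρ (x + Real.pi / 2)) ^ (n % 2) *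
    ∏ k ∈ Finset.Icc 1 (n / 2), (4 * ρ (x - a k) * ρ (x + a k)), ?_, ?_⟩
  · exact mul_pos (pow_pos (mul_pos two_pos (hρ _)) _)
      (Finset.prod_pos fun k _ => mul_pos (mul_pos four_pos (hρ _)) (hρ _))
  have h1 (y : ℝ) : 2 * Complex.cos (2 * (x + δ * Complex.I)) - 2 * Complex.cos (2 * (y : ℂ)) =
      (4 * ρ (x - y) * ρ (x + y) : ℝ) *
        Complex.exp (-(Complex.I * (phase r (x - y) + phase r (x + y) : ℝ))) := by
    have e1 := hsin (x - y)
    have e2 := hsin (x + y)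
    have e3 : Complex.exp (-(Complex.I * (phase r (x - y) + phase r (x + y) : ℝ))) =
        Complex.exp (-(Complex.I * (phase r (x - y) : ℝ))) *
          Complex.exp (-(Complex.I * (phase r (x + y) : ℝ))) := by
      rw [← Complex.exp_add]
      congr 1
      push_cast
      ring
    rw [← mul_sub, Complex.cos_sub_cos, e3]
    have e4 : (2 * (x + δ * Complex.I) + 2 * (y : ℂ)) / 2 = ((x + y : ℝ) : ℂ) + δ * Complex.I := by
      push_cast; ring
    have e5 : (2 * (x + δ * Complex.I) - 2 * (y : ℂ)) / 2 = ((x - y : ℝ) : ℂ) + δ * Complex.I := by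
      push_cast; ring
    rw [e4, e5, e1, e2]
    push_cast
    linear_combination (-4 * ρ (x - y) * ρ (x + y) *
      Complex.exp (-(Complex.I * (phase r (x - y) : ℝ))) *
          Complex.exp (-(Complex.I * (phase r (x + y) : ℝ)))) * Complex.I_sq
  have h2 : 2 * Complex.cos (x + δ * Complex.I) = (2 * ρ (x + Real.pi / 2) : ℝ) *
      Complex.exp (-(Complex.I * (phase r (x + Real.pi / 2) - Real.pi / 2 : ℝ))) := by
    have e1 := hsin (x + Real.pi / 2)
    have e2 : ((x + Real.pi / 2 : ℝ) : ℂ) + δ * Complex.I =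
        (x + δ * Complex.I) + Real.pi / 2 := by push_cast; ring
    have e3 : Complex.exp (-(Complex.I * (phase r (x + Real.pi / 2) - Real.pi / 2 : ℝ))) =
        Complex.I * Complex.exp (-(Complex.I * (phase r (x + Real.pi / 2) : ℝ))) := by
      nth_rw 2 [← Complex.exp_pi_div_two_mul_I]
      rw [← Complex.exp_add]
      congr 1
      push_cast
      ring
    rw [e2, Complex.sin_add_pi_div_two] at e1
    rw [e1, e3]
    push_cast
    ring
  have h3 : Complex.exp (-(Complex.I * (totalPhase n r a x : ℝ))) =
      Complex.exp (-(Complex.I * (phase r (x + Real.pi / 2) - Real.pi / 2 : ℝ))) ^ (n % 2) *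
      ∏ k ∈ Finset.Icc 1 (n / 2),
        Complex.exp (-(Complex.I * (phase r (x - a k) + phase r (x + a k) : ℝ))) := by
    rw [← Complex.exp_sum, ← Complex.exp_nat_mul, ← Complex.exp_add, totalPhase]
    congr 1
    rw [Finset.sum_neg_distrib, ← Finset.mul_sum, ← Complex.ofReal_sum]
    push_cast
    ring
  rw [trigProd, h2, h3]
  simp only [h1, Finset.prod_mul_distrib, mul_pow]
  push_cast
  simp only [Finset.prod_mul_distrib]
  ring

theorem trigProd_neg (n : ℕ) (a : ℕ → ℝ) (x : ℂ) : trigProd n a (-x) = trigProd n a x := by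
  simp only [trigProd, mul_neg, Complex.cos_neg]

theorem trigProd_conj (n : ℕ) (a : ℕ → ℝ) (x : ℂ) :
    trigProd n a ((starRingEnd ℂ) x) = (starRingEnd ℂ) (trigProd n a x) := by
  have h2 : (starRingEnd ℂ) (2 : ℂ) = 2 := Complex.conj_ofNat 2
  simp only [trigProd, map_mul, map_pow, map_prod, map_sub, ← Complex.cos_conj,
    Complex.conj_ofReal, h2]

/-- The exponential sum with coefficients `c` has principal zeros `a 1, …, a ⌊n/2⌋`, in any order;
`c 0` is its leading coefficient. -/
def IsFactored (n : ℕ) (c a : ℕ → ℝ) : Prop := ∀ x : ℂ, expSum n c x = c 0 * trigProd n a x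

/-- Multiplying the coefficient at frequency `j` by `cosh (jδ)` averages the two shifts by `± iδ`. -/
theorem expSum_mul_cosh (n : ℕ) (c : ℕ → ℝ) (δ : ℝ) (x : ℂ) :
    expSum n (fun k => c k * Real.cosh (((n : ℝ) - 2 * k) * δ)) x =
      (expSum n c (x + δ * Complex.I) + expSum n c (x - δ * Complex.I)) / 2 := by
  simp only [expSum]
  rw [← Finset.sum_add_distrib, Finset.sum_div]
  refine Finset.sum_congr rfl fun k _ => ?_
  have e1 : Complex.exp (Complex.I * (x + δ * Complex.I) * (n - 2 * k)) =
      Complex.exp (Complex.I * x * (n - 2 * k)) * Complex.exp (-((n - 2 * k) * δ)) := by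
    rw [← Complex.exp_add]
    congr 1
    linear_combination (δ * (n - 2 * k) : ℂ) * Complex.I_sq
  have e2 : Complex.exp (Complex.I * (x - δ * Complex.I) * (n - 2 * k)) =
      Complex.exp (Complex.I * x * (n - 2 * k)) * Complex.exp ((n - 2 * k) * δ) := by
    rw [← Complex.exp_add]
    congr 1
    linear_combination (-δ * (n - 2 * k) : ℂ) * Complex.I_sq
  rw [e1, e2]
  push_cast
  rw [Complex.cosh]
  ring

/-- At a real point `x` the average of the values at `x ± iδ` is the real part of the value at
`x + iδ`, so that it vanishes where the cosine of the total phase does. -/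
theorem IsFactored.expSum_mul_cosh_eq_zero {n : ℕ} {c a : ℕ → ℝ} (h : IsFactored n c a) {δ : ℝ}
    (hδ : 0 < δ) {x : ℝ} (hx : Real.cos (totalPhase n (Real.exp (-(2 * δ))) a x) = 0) :
    expSum n (fun k => c k * Real.cosh (((n : ℝ) - 2 * k) * δ)) x = 0 := by
  obtain ⟨R, -, hR⟩ := trigProd_add_mul_I n hδ a x
  have hconj : (x : ℂ) - δ * Complex.I = (starRingEnd ℂ) (x + δ * Complex.I) := by
    simp [sub_eq_add_neg]
  rw [expSum_mul_cosh, h, h, hconj, trigProd_conj, ← mul_add, Complex.add_conj, hR]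
  have : (R * Complex.exp (-(Complex.I *
      (totalPhase n (Real.exp (-(2 * δ))) a x : ℝ)))).re = 0 := by
    rw [Complex.re_ofReal_mul, show ∀ y : ℝ, -(Complex.I * (y : ℂ)) = ((-y : ℝ) : ℂ) * Complex.I by
      intro y; push_cast; ring, Complex.exp_ofReal_mul_I_re, Real.cos_neg, hx, mul_zero]
  rw [this]
  simp

/-- Averaging over the shifts by `± iδ` sends functions with real principal zeros `a` to functions with
real principal zeros `Φ a`, and `Φ` is order preserving.  The `k`-th coordinate of `Φ a` is the point
where the total phase takes the value `(k - 1/2)π`; it is set to `π/2` for the irrelevant indices. -/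
theorem exists_order_preserving_step {n : ℕ} (hn : 0 < n) {δ : ℝ} (hδ : 0 < δ) :
    ∃ Φ : (ℕ → ℝ) → ℕ → ℝ,
      (∀ a k, Φ a k ∈ Icc 0 (Real.pi / 2)) ∧
      (∀ a, MonotoneOn (Φ a) (Icc 1 (n / 2))) ∧
      (∀ a c, IsFactored n c a →
        IsFactored n (fun k => c k * Real.cosh (((n : ℝ) - 2 * k) * δ)) (Φ a)) ∧
      ∀ a a' : ℕ → ℝ, (∀ k, a k ∈ Icc 0 (Real.pi / 2)) → (∀ k, a' k ∈ Icc 0 (Real.pi / 2)) →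
        a' ≤ a → Φ a' ≤ Φ a := by
  set r := Real.exp (-(2 * δ)) with hr
  have hr1 : r ∈ Ioo (0 : ℝ) 1 := ⟨Real.exp_pos _, by rw [Real.exp_lt_one_iff]; linarith⟩
  have hpi := Real.pi_pos
  have hex : ∀ (a : ℕ → ℝ) (k : ℕ), ∃ b ∈ Icc 0 (Real.pi / 2), (k ∈ Icc 1 (n / 2) →
      b ∈ Ioo 0 (Real.pi / 2) ∧ totalPhase n r a b = ((k : ℝ) - 1 / 2) * Real.pi) ∧
      (k ∉ Icc 1 (n / 2) → b = Real.pi / 2) := by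
    intro a k
    by_cases hk : k ∈ Icc 1 (n / 2)
    · have h1 : (1 : ℝ) ≤ k := by exact_mod_cast hk.1
      have h2 : 2 * (k : ℝ) ≤ n := by
        have : 2 * k ≤ n := by have := hk.2; lia
        exact_mod_cast this
      have hmem : ((k : ℝ) - 1 / 2) * Real.pi ∈
          Ioo (totalPhase n r a 0) (totalPhase n r a (Real.pi / 2)) := by
        rw [totalPhase_zero, totalPhase_pi_div_two]
        constructor <;> nlinarith
      obtain ⟨b, hb, hb'⟩ := intermediate_value_Ioo (by positivity)
        (continuous_totalPhase n hr1 a).continuousOn hmem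
      exact ⟨b, Ioo_subset_Icc_self hb, fun _ => ⟨hb, hb'⟩, fun h => absurd hk h⟩
    · exact ⟨Real.pi / 2, right_mem_Icc.mpr (by positivity), fun h => absurd h hk, fun _ => rfl⟩
  choose Φ hΦ hΦ1 hΦ2 using hex
  have hstrict : ∀ a, StrictMonoOn (Φ a) (Icc 1 (n / 2)) := by
    intro a k hk l hl hkl
    rw [← (strictMono_totalPhase hn hr1 a).lt_iff_lt, (hΦ1 a k hk).2, (hΦ1 a l hl).2]
    have : (k : ℝ) < l := by exact_mod_cast hkl
    nlinarith
  refine ⟨Φ, hΦ, fun a => (hstrict a).monotoneOn, ?_, ?_⟩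
  · intro a c hac
    have hz (k : ℕ) (hk : k ∈ Icc 1 (n / 2)) :
        expSum n (fun k => c k * Real.cosh (((n : ℝ) - 2 * k) * δ)) (Φ a k) = 0 := by
      refine hac.expSum_mul_cosh_eq_zero hδ ?_
      rw [← hr, (hΦ1 a k hk).2, Real.cos_eq_zero_iff]
      refine ⟨(k : ℤ) - 1, ?_⟩
      push_cast
      ring
    refine fun x => expSum_eq_trigProd (fun k hk => (hΦ1 a k hk).1) (hstrict a) hz ?_ ?_ x
    · intro k hk
      rw [← hz k hk, expSum_mul_cosh, expSum_mul_cosh, hac, hac, hac, hac,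
        ← trigProd_neg n a (-Φ a k + δ * Complex.I), ← trigProd_neg n a (-Φ a k - δ * Complex.I)]
      ring_nf
    · intro hodd
      refine hac.expSum_mul_cosh_eq_zero hδ ?_
      rw [totalPhase_pi_div_two, Real.cos_eq_zero_iff]
      refine ⟨((n / 2 : ℕ) : ℤ), ?_⟩
      have := congrArg (Nat.cast (R := ℝ)) (Nat.mod_add_div n 2)
      rw [hodd] at this
      push_cast at this
      rw [Int.cast_natCast]
      linear_combination (-Real.pi / 2) * this
  · intro a a' ha ha' h k
    by_cases hk : k ∈ Icc 1 (n / 2)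
    · rw [← (strictMono_totalPhase hn hr1 a').le_iff_le, (hΦ1 a' k hk).2, ← (hΦ1 a k hk).2]
      exact totalPhase_anti hr1 ha ha' h (hΦ a k)
    · rw [hΦ2 a k hk, hΦ2 a' k hk]

/-! ### From repeated averaging to the heat flow -/

theorem IsFactored.of_tendsto {n : ℕ} {c a : ℕ → ℝ} {cs as : ℕ → ℕ → ℝ}
    (h : ∀ i, IsFactored n (cs i) (as i)) (hc : ∀ k, Tendsto (fun i => cs i k) atTop (𝓝 (c k)))
    (ha : Tendsto as atTop (𝓝 a)) : IsFactored n c a := by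
  intro x
  have ha' (k : ℕ) : Tendsto (fun i => as i k) atTop (𝓝 (a k)) := tendsto_pi_nhds.mp ha k
  have hc' (k : ℕ) : Tendsto (fun i => (cs i k : ℂ)) atTop (𝓝 (c k : ℂ)) :=
    (Complex.continuous_ofReal.tendsto _).comp (hc k)
  have h1 : Tendsto (fun i => expSum n (cs i) x) atTop (𝓝 (expSum n c x)) :=
    tendsto_finsetSum _ fun k _ => (hc' k).mul_const _
  have h2 : Tendsto (fun i => cs i 0 * trigProd n (as i) x) atTop (𝓝 (c 0 * trigProd n a x)) := by
    refine (hc' 0).mul (Tendsto.const_mul _ (tendsto_finsetProd _ fun k _ => ?_))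
    have hcos : Continuous fun y : ℝ =>
      2 * Complex.cos (2 * x) - 2 * Complex.cos (2 * (y : ℂ)) := by fun_prop
    exact (hcos.tendsto _).comp (ha' k)
  simp only [h _ x] at h1
  exact tendsto_nhds_unique h1 h2

theorem one_add_sq_div_two_le_cosh (x : ℝ) : 1 + x ^ 2 / 2 ≤ Real.cosh x := by
  have h1 : |x| / 2 ≤ Real.sinh (|x| / 2) := Real.self_le_sinh_iff.mpr (by positivity)
  have h2 := Real.cosh_two_mul (|x| / 2)
  rw [mul_div_cancel₀ _ two_ne_zero, Real.cosh_abs, Real.cosh_sq] at h2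
  have h3 := pow_le_pow_left₀ (by positivity) h1 2
  rw [div_pow, sq_abs] at h3
  linarith

theorem tendsto_mul_log_cosh (y : ℝ) :
    Tendsto (fun N : ℕ => (N : ℝ) * Real.log (Real.cosh (y / √N))) atTop (𝓝 (y ^ 2 / 2)) := by
  have hinv : Tendsto (fun N : ℕ => ((N : ℝ))⁻¹) atTop (𝓝 0) :=
    tendsto_inv_atTop_zero.comp tendsto_natCast_atTop_atTop
  have hlow : Tendsto (fun N : ℕ => (y ^ 2 / 2) / (1 + y ^ 2 / 2 * (N : ℝ)⁻¹)) atTop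
      (𝓝 (y ^ 2 / 2)) := by
    have h1 := (hinv.const_mul (y ^ 2 / 2)).const_add 1
    have h2 : Tendsto (fun N : ℕ => (y ^ 2 / 2) / (1 + y ^ 2 / 2 * (N : ℝ)⁻¹)) atTop
        (𝓝 (y ^ 2 / 2 / (1 + y ^ 2 / 2 * 0))) := tendsto_const_nhds.div h1 (by simp)
    simpa using h2
  refine tendsto_of_tendsto_of_tendsto_of_le_of_le' hlow tendsto_const_nhds ?_ ?_
  · filter_upwards [eventually_gt_atTop 0] with N hN
    have hN' : (0 : ℝ) < N := by exact_mod_cast hN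
    have hsq : (y / √N) ^ 2 = y ^ 2 / N := by rw [div_pow, Real.sq_sqrt hN'.le]
    have hc : 1 + y ^ 2 / N / 2 ≤ Real.cosh (y / √N) := by
      rw [← hsq]
      exact one_add_sq_div_two_le_cosh _
    have hp : 0 < 1 + y ^ 2 / N / 2 := by positivity
    have h1 := (Real.one_sub_inv_le_log_of_pos hp).trans (Real.log_le_log hp hc)
    refine le_trans (le_of_eq ?_) (mul_le_mul_of_nonneg_left h1 hN'.le)
    field_simp
    ring
  · filter_upwards [eventually_gt_atTop 0] with N hN
    have hN' : (0 : ℝ) < N := by exact_mod_cast hN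
    have hsq : (y / √N) ^ 2 = y ^ 2 / N := by rw [div_pow, Real.sq_sqrt hN'.le]
    have h1 := Real.log_le_log (Real.cosh_pos _) (Real.cosh_le_exp_half_sq (y / √N))
    rw [Real.log_exp, hsq] at h1
    refine (mul_le_mul_of_nonneg_left h1 hN'.le).trans (le_of_eq ?_)
    field_simp

/-- About `2tN` averaging steps of size `1/√N` multiply the coefficient at frequency `y` by a factor
that converges to `e^{t y²}`. -/
theorem tendsto_cosh_pow {t : ℝ} (ht : 0 ≤ t) (y : ℝ) :
    Tendsto (fun N : ℕ => Real.cosh (y / √N) ^ ⌊2 * t * N⌋₊) atTop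
      (𝓝 (Real.exp (t * y ^ 2))) := by
  have h1 : Tendsto (fun N : ℕ => (⌊2 * t * N⌋₊ : ℝ) / N) atTop (𝓝 (2 * t)) :=
    (tendsto_nat_floor_mul_div_atTop (by positivity)).comp tendsto_natCast_atTop_atTop
  have h2 := (Real.continuous_exp.tendsto _).comp (h1.mul (tendsto_mul_log_cosh y))
  rw [show 2 * t * (y ^ 2 / 2) = t * y ^ 2 by ring] at h2
  refine h2.congr' ?_
  filter_upwards [eventually_gt_atTop 0] with N hN
  have hN' : (N : ℝ) ≠ 0 := by exact_mod_cast hN.ne'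
  rw [Function.comp_apply, div_mul_eq_mul_div, ← mul_assoc, mul_comm _ (N : ℝ), mul_assoc,
    mul_div_cancel_left₀ _ hN', Real.exp_nat_mul, Real.exp_log (Real.cosh_pos _)]

/-- The zeros after `M` averaging steps, starting from `(2 cos x)ⁿ`, decrease in `M`: the first step
can only lower zeros that are all equal to `π/2`, and each step preserves the order. -/
theorem exists_iterated_factorization {n : ℕ} (hn : 0 < n) {δ : ℝ} (hδ : 0 < δ) :
    ∃ b : ℕ → ℕ → ℝ, (∀ M k, b M k ∈ Icc 0 (Real.pi / 2)) ∧
      (∀ M, MonotoneOn (b M) (Icc 1 (n / 2))) ∧ Antitone b ∧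
      ∀ M, IsFactored n
        (fun k => n.choose k * Real.cosh (((n : ℝ) - 2 * k) * δ) ^ M) (b M) := by
  obtain ⟨Φ, hΦ, hmono, hfac, hord⟩ := exists_order_preserving_step hn hδ
  have hpi := Real.pi_pos
  set top : ℕ → ℝ := fun _ => Real.pi / 2 with htop
  have hmem (M k : ℕ) : (Φ^[M] top) k ∈ Icc 0 (Real.pi / 2) := by
    cases M with
    | zero => exact right_mem_Icc.mpr (by positivity)
    | succ M => rw [Function.iterate_succ_apply']; exact hΦ _ _
  refine ⟨fun M => Φ^[M] top, hmem, fun M => ?_, antitone_nat_of_succ_le fun M => ?_, fun M => ?_⟩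
  · cases M with
    | zero => exact monotoneOn_const
    | succ M => simp only [Function.iterate_succ_apply']; exact hmono _
  · induction M with
    | zero => exact fun k => (hΦ top k).2
    | succ M ih =>
      rw [Function.iterate_succ_apply' Φ (M + 1)]
      nth_rw 2 [Function.iterate_succ_apply']
      exact hord _ _ (hmem M) (hmem (M + 1)) ih
  · induction M with
    | zero =>
      intro x
      simp only [pow_zero, mul_one, Function.iterate_zero, id_eq]
      rw [expSum_choose]
      simp [htop]
    | succ M ih =>
      have := hfac _ _ ih
      simp only [Function.iterate_succ_apply', pow_succ, ← mul_assoc]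
      exact this

/-- At all times the zeros are real, and they decrease weakly.  Both configurations are limits of
configurations after repeated averaging with the same step, along a common subsequence. -/
theorem exists_ordered_factorizations {n : ℕ} (hn : 0 < n) {t t' : ℝ} (ht : 0 ≤ t)
    (htt' : t ≤ t') :
    ∃ a a' : ℕ → ℝ, (∀ k, a k ∈ Icc 0 (Real.pi / 2)) ∧ (∀ k, a' k ∈ Icc 0 (Real.pi / 2)) ∧
      MonotoneOn a (Icc 1 (n / 2)) ∧ MonotoneOn a' (Icc 1 (n / 2)) ∧ a' ≤ a ∧
      IsFactored n (isingCoeff n t) a ∧ IsFactored n (isingCoeff n t') a' := by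
  have hδ (N : ℕ) : (0 : ℝ) < 1 / √((N + 1 : ℕ) : ℝ) := by positivity
  choose b hb hbm hba hbf using fun N => exists_iterated_factorization hn (hδ N)
  set box : Set (ℕ → ℝ) := univ.pi fun _ => Icc 0 (Real.pi / 2) with hbox
  have hcomp : IsCompact box := isCompact_univ_pi fun _ => isCompact_Icc
  have hmem (N M : ℕ) : b N M ∈ box := fun k _ => hb N M k
  set M : ℝ → ℕ → ℕ := fun s N => ⌊2 * s * ((N + 1 : ℕ) : ℝ)⌋₊ with hM
  obtain ⟨⟨a, a'⟩, ⟨ha, ha'⟩, φ, hφ, hlim⟩ := (hcomp.prod hcomp).tendsto_subseq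
    (x := fun N => (b N (M t N), b N (M t' N))) fun N => ⟨hmem _ _, hmem _ _⟩
  have hl : Tendsto (fun i => b (φ i) (M t (φ i))) atTop (𝓝 a) :=
    (continuous_fst.tendsto (a, a')).comp hlim
  have hl' : Tendsto (fun i => b (φ i) (M t' (φ i))) atTop (𝓝 a') :=
    (continuous_snd.tendsto (a, a')).comp hlim
  have hcoeff {s : ℝ} (hs : 0 ≤ s) (k : ℕ) : Tendsto (fun i => (n.choose k : ℝ) *
      Real.cosh (((n : ℝ) - 2 * k) * (1 / √((φ i + 1 : ℕ) : ℝ))) ^ M s (φ i)) atTop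
      (𝓝 (isingCoeff n s k)) := by
    refine Tendsto.const_mul _ ?_
    have h := (tendsto_cosh_pow hs ((n : ℝ) - 2 * k)).comp
      ((tendsto_add_atTop_nat 1).comp hφ.tendsto_atTop)
    refine h.congr fun i => ?_
    simp only [Function.comp_apply, hM, mul_one_div]
  have hmono {s : ℝ} {e : ℕ → ℝ} (he : Tendsto (fun i => b (φ i) (M s (φ i))) atTop (𝓝 e)) :
      MonotoneOn e (Icc 1 (n / 2)) := fun k hk l hl hkl =>
    le_of_tendsto_of_tendsto' (tendsto_pi_nhds.mp he k) (tendsto_pi_nhds.mp he l)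
      fun i => hbm _ _ hk hl hkl
  refine ⟨a, a', fun k => ha k trivial, fun k => ha' k trivial, hmono hl, hmono hl', ?_,
    IsFactored.of_tendsto (fun i => hbf _ _) (hcoeff ht) hl,
    IsFactored.of_tendsto (fun i => hbf _ _) (hcoeff (ht.trans htt')) hl'⟩
  refine le_of_tendsto_of_tendsto' hl' hl fun i => hba _ ?_
  simp only [hM]
  gcongr

/-! ### Multiplicities of zeros -/

open Classical in
theorem translatedCount_eq (a : ℝ) (w : ℂ) :
    translatedCount a w = if ∃ m : ℤ, w = a + m * Real.pi then 1 else 0 := by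
  split_ifs with h
  · obtain ⟨m, hm⟩ := h
    rw [translatedCount, Set.encard_eq_one]
    refine ⟨m, Set.ext fun l => ⟨fun hl => ?_, ?_⟩⟩
    · have hpi : (Real.pi : ℂ) ≠ 0 := by exact_mod_cast Real.pi_ne_zero
      have hl' : w = a + l * Real.pi := hl
      have h1 : (l : ℂ) * Real.pi = m * Real.pi := add_left_cancel (hl'.symm.trans hm)
      exact_mod_cast mul_right_cancel₀ hpi h1
    · rintro rfl
      exact hm
  · rw [translatedCount, Set.encard_eq_zero]
    exact Set.eq_empty_of_forall_notMem fun m hm => h ⟨m, hm⟩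

theorem reflectedCount_eq (a : ℝ) (w : ℂ) :
    reflectedCount a w = translatedCount a w + translatedCount (-a) w := by
  have h : {p : ℤˣ × ℤ | w = ((p.1 : ℤ) : ℂ) * (a : ℂ) + (p.2 : ℂ) * (Real.pi : ℂ)} =
      Prod.mk (1 : ℤˣ) '' {m : ℤ | w = (a : ℂ) + (m : ℂ) * (Real.pi : ℂ)} ∪
        Prod.mk (-1 : ℤˣ) '' {m : ℤ | w = ((-a : ℝ) : ℂ) + (m : ℂ) * (Real.pi : ℂ)} := by
    ext ⟨s, m⟩
    rcases Int.units_eq_one_or s with rfl | rfl <;> simp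
  rw [reflectedCount, h, Set.encard_union_eq, (Prod.mk_right_injective _).encard_image,
    (Prod.mk_right_injective _).encard_image]
  · rfl
  · rw [Set.disjoint_left]
    rintro _ ⟨m, -, rfl⟩ ⟨l, -, h⟩
    exact (show (-1 : ℤˣ) ≠ 1 by decide) (congrArg Prod.fst h)

theorem analyticOrderAt_sin_sub (a : ℝ) (w : ℂ) :
    analyticOrderAt (fun z : ℂ => Complex.sin (z - a)) w = translatedCount a w := by
  classical
  have han : AnalyticAt ℂ (fun z : ℂ => Complex.sin (z - a)) w := by fun_prop
  have hz : Complex.sin (w - a) = 0 ↔ ∃ m : ℤ, w = a + m * Real.pi := by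
    rw [Complex.sin_eq_zero_iff]
    simp only [sub_eq_iff_eq_add']
  rw [translatedCount_eq]
  split_ifs with h
  · have h0 := hz.mpr h
    refine han.analyticOrderAt_eq_one_of_zero_deriv_ne_zero h0 ?_
    have hd : HasDerivAt (fun z : ℂ => Complex.sin (z - a)) (Complex.cos (w - a) * 1) w :=
      ((hasDerivAt_id w).sub_const (a : ℂ)).csin
    rw [hd.deriv, mul_one]
    intro hc
    have := Complex.sin_sq_add_cos_sq (w - a)
    rw [h0, hc] at this
    norm_num at this
  · exact han.analyticOrderAt_eq_zero.mpr fun h0 => h (hz.mp h0)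

theorem analyticOrderAt_const_mul {f : ℂ → ℂ} {w L : ℂ} (hf : AnalyticAt ℂ f w) (hL : L ≠ 0) :
    analyticOrderAt (fun z => L * f z) w = analyticOrderAt f w := by
  have h0 : analyticOrderAt (fun _ : ℂ => L) w = 0 :=
    analyticAt_const.analyticOrderAt_eq_zero.mpr hL
  have := analyticOrderAt_mul (f := fun _ : ℂ => L) analyticAt_const hf
  rwa [h0, zero_add] at this

theorem analyticOrderAt_finset_prod {ι : Type*} (s : Finset ι) {f : ι → ℂ → ℂ} {w : ℂ}
    (hf : ∀ i ∈ s, AnalyticAt ℂ (f i) w) :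
    analyticOrderAt (fun z => ∏ i ∈ s, f i z) w = ∑ i ∈ s, analyticOrderAt (f i) w := by
  classical
  induction s using Finset.induction_on with
  | empty =>
    simp only [Finset.prod_empty, Finset.sum_empty]
    exact analyticAt_const.analyticOrderAt_eq_zero.mpr one_ne_zero
  | insert i s hi ih =>
    have hs : ∀ j ∈ s, AnalyticAt ℂ (f j) w := fun j hj => hf j (Finset.mem_insert_of_mem hj)
    simp only [Finset.prod_insert hi, Finset.sum_insert hi, ← ih hs]
    exact analyticOrderAt_mul (hf i (Finset.mem_insert_self i s))
      (Finset.analyticAt_fun_prod s hs)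

theorem analyticOrderAt_cos_sub_cos (a : ℝ) (w : ℂ) :
    analyticOrderAt (fun z : ℂ => 2 * Complex.cos (2 * z) - 2 * Complex.cos (2 * (a : ℂ))) w =
      reflectedCount a w := by
  have h : (fun z : ℂ => 2 * Complex.cos (2 * z) - 2 * Complex.cos (2 * (a : ℂ))) =
      fun z => (-4 : ℂ) * (((fun z : ℂ => Complex.sin (z - a)) *
        (fun z : ℂ => Complex.sin (z - (-a : ℝ)))) z) := by
    funext z
    rw [← mul_sub, Complex.cos_sub_cos, Pi.mul_apply]
    push_cast
    ring_nf
  have h1 : AnalyticAt ℂ (fun z : ℂ => Complex.sin (z - a)) w := by fun_prop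
  have h2 : AnalyticAt ℂ (fun z : ℂ => Complex.sin (z - (-a : ℝ))) w := by fun_prop
  rw [h, analyticOrderAt_const_mul (h1.mul h2) (by norm_num), analyticOrderAt_mul h1 h2,
    analyticOrderAt_sin_sub, analyticOrderAt_sin_sub, reflectedCount_eq]

theorem analyticOrderAt_two_cos (w : ℂ) :
    analyticOrderAt (fun z : ℂ => 2 * Complex.cos z) w = translatedCount (Real.pi / 2) w := by
  have h : (fun z : ℂ => 2 * Complex.cos z) =
      fun z => (-2 : ℂ) * Complex.sin (z - (Real.pi / 2 : ℝ)) := by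
    funext z
    push_cast
    rw [Complex.sin_sub_pi_div_two]
    ring
  rw [h, analyticOrderAt_const_mul (by fun_prop) (by norm_num), analyticOrderAt_sin_sub]

theorem IsFactored.analyticOrderAt_eq {n : ℕ} {c a : ℕ → ℝ} (h : IsFactored n c a) (hc : c 0 ≠ 0)
    (w : ℂ) : analyticOrderAt (expSum n c) w =
      (∑ k ∈ Finset.Icc 1 (n / 2), reflectedCount (a k) w) +
        if n % 2 = 1 then translatedCount (Real.pi / 2) w else 0 := by
  have hp : ∀ k ∈ Finset.Icc 1 (n / 2), AnalyticAt ℂ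
      (fun z : ℂ => 2 * Complex.cos (2 * z) - 2 * Complex.cos (2 * (a k : ℂ))) w :=
    fun k _ => by fun_prop
  have hp' := Finset.analyticAt_fun_prod _ hp
  have hcos : AnalyticAt ℂ (fun z : ℂ => 2 * Complex.cos z) w := by fun_prop
  have hprod : trigProd n a = ((fun z : ℂ => 2 * Complex.cos z) ^ (n % 2)) *
      fun z => ∏ k ∈ Finset.Icc 1 (n / 2),
        (2 * Complex.cos (2 * z) - 2 * Complex.cos (2 * (a k : ℂ))) := rfl
  have hL : (c 0 : ℂ) ≠ 0 := by exact_mod_cast hc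
  rw [show expSum n c = fun z => (c 0 : ℂ) * trigProd n a z from funext h,
    analyticOrderAt_const_mul (by rw [hprod]; exact (hcos.pow _).mul hp') hL, hprod,
    analyticOrderAt_mul (hcos.pow _) hp', analyticOrderAt_pow hcos, analyticOrderAt_finset_prod _ hp,
    analyticOrderAt_two_cos, add_comm]
  simp only [analyticOrderAt_cos_sub_cos]
  rcases Nat.mod_two_eq_zero_or_one n with hm | hm <;> simp [hm]

theorem translatedCount_ofReal {a u : ℝ} (ha : a ∈ Ioc 0 (Real.pi / 2))
    (hu : u ∈ Ioc 0 (Real.pi / 2)) : translatedCount a u = if a = u then 1 else 0 := by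
  classical
  have hpi := Real.pi_pos
  rw [translatedCount_eq]
  refine if_congr ⟨?_, fun h => ⟨0, by simp [h]⟩⟩ rfl rfl
  rintro ⟨m, hm⟩
  have hm' : u = a + m * Real.pi := by exact_mod_cast hm
  have h1 : (m : ℝ) < 1 := by
    by_contra! h
    nlinarith [ha.1, hu.2]
  have h2 : (-1 : ℝ) < m := by
    by_contra! h
    nlinarith [ha.2, hu.1]
  have h3 : m < 1 := by exact_mod_cast h1
  have h4 : -1 < m := by exact_mod_cast h2
  obtain rfl : m = 0 := by lia
  simpa using hm'.symm

theorem translatedCount_neg_ofReal {a u : ℝ} (ha : a ∈ Ioc 0 (Real.pi / 2))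
    (hu : u ∈ Ioo 0 (Real.pi / 2)) : translatedCount (-a) u = 0 := by
  classical
  have hpi := Real.pi_pos
  rw [translatedCount_eq, if_neg]
  rintro ⟨m, hm⟩
  have hm' : u = -a + m * Real.pi := by exact_mod_cast hm
  have h1 : (m : ℝ) < 1 := by
    by_contra! h
    nlinarith [ha.2, hu.2]
  have h2 : (0 : ℝ) < m := by
    by_contra! h
    nlinarith [ha.1, hu.1]
  have h3 : m < 1 := by exact_mod_cast h1
  have h4 : 0 < m := by exact_mod_cast h2
  lia

/-! ### The `k`-th positive zero -/

/-- The `k`-th point of a sorted list in `(0, B]` is recovered from a multiplicity function `o` that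
counts the list exactly on `(0, B)`.  At `B` a lower bound suffices, since the excess at `B` comes after
all listed points. -/
theorem sInf_count_le_finsum_eq {o : ℝ → ℕ∞} {b : ℕ → ℝ} {M k : ℕ} {B : ℝ}
    (hb : ∀ j ∈ Icc 1 M, b j ∈ Ioc 0 B) (hmono : MonotoneOn b (Icc 1 M))
    (ho : ∀ u ∈ Ioo 0 B, o u = ∑ j ∈ Finset.Icc 1 M, if b j = u then 1 else 0)
    (hoB : ∑ j ∈ Finset.Icc 1 M, (if b j = B then 1 else 0) ≤ o B) (hk : k ∈ Icc 1 M) :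
    sInf {y : ℝ | 0 < y ∧ (k : ℕ∞) ≤ ∑ᶠ u ∈ Ioc (0 : ℝ) y, o u} = b k := by
  classical
  set S : Finset ℝ := insert B ((Finset.Icc 1 M).image b) with hS
  have hbS : ∀ j ∈ Icc 1 M, b j ∈ S := fun j hj =>
    Finset.mem_insert_of_mem (Finset.mem_image_of_mem b (by simpa using hj))
  have hcount (y : ℝ) (hy : y ≤ B) :
      ∑ᶠ u ∈ Ioc (0 : ℝ) y, o u = ∑ u ∈ S with u ∈ Ioc 0 y, o u := by
    refine finsum_mem_eq_sum_of_subset _ ?_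
      fun u hu => (Finset.mem_filter.mp (Finset.mem_coe.mp hu)).2
    rintro u ⟨hu, hou⟩
    refine Finset.mem_coe.mpr (Finset.mem_filter.mpr ⟨?_, hu⟩)
    rcases (hu.2.trans hy).eq_or_lt with rfl | huB
    · exact Finset.mem_insert_self _ _
    · rw [Function.mem_support, ho u ⟨hu.1, huB⟩] at hou
      obtain ⟨j, hj, hju⟩ := Finset.exists_ne_zero_of_sum_ne_zero hou
      have : b j = u := by
        by_contra h
        simp [h] at hju
      rw [← this]
      exact hbS j (by simpa using hj)
  have hswap (y : ℝ) (hy : y ≤ B) :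
      ∑ u ∈ S with u ∈ Ioc 0 y, ∑ j ∈ Finset.Icc 1 M, (if b j = u then (1 : ℕ∞) else 0) =
        (((Finset.Icc 1 M).filter fun j => b j ≤ y).card : ℕ∞) := by
    rw [Finset.sum_comm, Finset.card_filter, Nat.cast_sum]
    refine Finset.sum_congr rfl fun j hj => ?_
    have hj' : j ∈ Icc 1 M := by simpa using hj
    rw [Finset.sum_ite_eq]
    simp [hbS j hj', (hb j hj').1]
  refine IsLeast.csInf_eq ⟨⟨(hb k hk).1, ?_⟩, ?_⟩
  · rw [hcount _ (hb k hk).2]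
    have h1 : (k : ℕ∞) ≤ (((Finset.Icc 1 M).filter fun j => b j ≤ b k).card : ℕ∞) := by
      have : Finset.Icc 1 k ⊆ (Finset.Icc 1 M).filter fun j => b j ≤ b k := by
        intro j hj
        rw [Finset.mem_Icc] at hj
        have hjM : j ∈ Icc 1 M := ⟨hj.1, hj.2.trans hk.2⟩
        rw [Finset.mem_filter, Finset.mem_Icc]
        exact ⟨hjM, hmono hjM hk hj.2⟩
      have := Finset.card_le_card this
      rw [Nat.card_Icc, Nat.add_sub_cancel] at this
      exact_mod_cast this
    refine h1.trans ?_
    rw [← hswap _ (hb k hk).2]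
    refine Finset.sum_le_sum fun u hu => ?_
    have hu' := (Finset.mem_filter.mp hu).2
    rcases (hu'.2.trans (hb k hk).2).eq_or_lt with rfl | huB
    · exact hoB
    · exact (ho u ⟨hu'.1, huB⟩).ge
  · rintro y ⟨hy0, hy⟩
    by_contra! hyk
    have hyB : y < B := hyk.trans_le (hb k hk).2
    rw [hcount y hyB.le] at hy
    have h1 : ∑ u ∈ S with u ∈ Ioc 0 y, o u =
        (((Finset.Icc 1 M).filter fun j => b j ≤ y).card : ℕ∞) := by
      rw [← hswap y hyB.le]
      refine Finset.sum_congr rfl fun u hu => ?_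
      have hu' := (Finset.mem_filter.mp hu).2
      exact ho u ⟨hu'.1, hu'.2.trans_lt hyB⟩
    rw [h1, Nat.cast_le] at hy
    have h2 : (Finset.Icc 1 M).filter (fun j => b j ≤ y) ⊆ Finset.Icc 1 (k - 1) := by
      intro j hj
      rw [Finset.mem_filter, Finset.mem_Icc] at hj
      have : j < k := by
        by_contra! h
        exact absurd (hmono hk hj.1 h) (by linarith [hj.2])
      rw [Finset.mem_Icc]
      exact ⟨hj.1.1, by lia⟩
    have := Finset.card_le_card h2
    rw [Nat.card_Icc] at this
    have := hk.1
    lia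

/-- The `k`-th positive zero of `f`, counted with multiplicity, by the same formula as `zero`; it also
applies to the rescaled limit as `t → ∞`. -/
noncomputable def kthZero (f : ℂ → ℂ) (k : ℕ) : ℝ :=
  sInf {y : ℝ | 0 < y ∧ (k : ℕ∞) ≤ ∑ᶠ u ∈ Ioc (0 : ℝ) y, analyticOrderAt f (u : ℂ)}

/-- Sorted principal zeros in `(0, π/2]` are the first positive zeros, followed by `π/2` for odd `n`.
In particular they are determined by the function. -/
theorem IsFactored.kthZero_eq {n : ℕ} {c a : ℕ → ℝ} (h : IsFactored n c a) (hc : c 0 ≠ 0)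
    (ha : ∀ k ∈ Icc 1 (n / 2), a k ∈ Ioc 0 (Real.pi / 2)) (hmono : MonotoneOn a (Icc 1 (n / 2)))
    {k : ℕ} (hk : k ∈ Icc 1 (n / 2 + n % 2)) :
    kthZero (expSum n c) k = if k ≤ n / 2 then a k else Real.pi / 2 := by
  have hpi := Real.pi_pos
  set b : ℕ → ℝ := fun k => if k ≤ n / 2 then a k else Real.pi / 2 with hb
  have hbm : ∀ j ∈ Icc 1 (n / 2 + n % 2), b j ∈ Ioc 0 (Real.pi / 2) := by
    intro j hj
    simp only [hb]
    split_ifs with hjn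
    · exact ha j ⟨hj.1, hjn⟩
    · exact right_mem_Ioc.mpr (by positivity)
  have hsum (u : ℝ) : (∑ j ∈ Finset.Icc 1 (n / 2 + n % 2), if b j = u then (1 : ℕ∞) else 0) =
      (∑ j ∈ Finset.Icc 1 (n / 2), if a j = u then (1 : ℕ∞) else 0) +
        if n % 2 = 1 then (if Real.pi / 2 = u then (1 : ℕ∞) else 0) else 0 := by
    have h1 : (∑ j ∈ Finset.Icc 1 (n / 2), if b j = u then (1 : ℕ∞) else 0) =
        ∑ j ∈ Finset.Icc 1 (n / 2), if a j = u then (1 : ℕ∞) else 0 := by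
      refine Finset.sum_congr rfl fun j hj => ?_
      simp [hb, (Finset.mem_Icc.mp hj).2]
    rcases Nat.mod_two_eq_zero_or_one n with hm | hm
    · simp [hm, h1]
    · rw [hm, Finset.sum_Icc_succ_top (by lia), h1]
      simp [hb]
  refine sInf_count_le_finsum_eq (B := Real.pi / 2) hbm ?_ ?_ ?_ hk
  · intro i hi j hj hij
    simp only [hb]
    split_ifs with h1 h2 h2
    · exact hmono ⟨hi.1, h1⟩ ⟨hj.1, h2⟩ hij
    · exact (ha i ⟨hi.1, h1⟩).2
    · lia
    · exact le_rfl
  · intro u hu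
    have hu' := Ioo_subset_Ioc_self hu
    rw [hsum, h.analyticOrderAt_eq hc]
    congr 1
    · refine Finset.sum_congr rfl fun j hj => ?_
      have hj' := ha j (by simpa using hj)
      rw [reflectedCount_eq, translatedCount_ofReal hj' hu', translatedCount_neg_ofReal hj' hu,
        add_zero]
    · rw [translatedCount_ofReal (right_mem_Ioc.mpr (by positivity)) hu']
  · have hB : Real.pi / 2 ∈ Ioc 0 (Real.pi / 2) := right_mem_Ioc.mpr (by positivity)
    rw [hsum, h.analyticOrderAt_eq hc]
    refine add_le_add (Finset.sum_le_sum fun j hj => ?_) ?_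
    · rw [reflectedCount_eq, translatedCount_ofReal (ha j (by simpa using hj)) hB]
      exact le_self_add
    · rw [translatedCount_ofReal hB hB]

/-! ### The zeros of the partition function -/

theorem zero_eq_kthZero (n k : ℕ) (t : ℝ) : zero n k t = kthZero (expSum n (isingCoeff n t)) k := by
  rw [← partitionFunction_eq_expSum]
  rfl

theorem isingCoeff_zero_pos (n : ℕ) (t : ℝ) : 0 < isingCoeff n t 0 := by
  simp [isingCoeff, Real.exp_pos]

theorem isingCoeff_nonneg (n : ℕ) (t : ℝ) (k : ℕ) : 0 ≤ isingCoeff n t k := by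
  unfold isingCoeff
  positivity

theorem trigProd_congr {n : ℕ} {a b : ℕ → ℝ} (h : ∀ k ∈ Icc 1 (n / 2), a k = b k) (x : ℂ) :
    trigProd n a x = trigProd n b x := by
  unfold trigProd
  congr 1
  refine Finset.prod_congr rfl fun k hk => ?_
  rw [h k (by simpa using hk)]

theorem trigProd_apply_self {n : ℕ} {a : ℕ → ℝ} {k : ℕ} (hk : k ∈ Icc 1 (n / 2)) :
    trigProd n a (a k) = 0 := by
  rw [trigProd, Finset.prod_eq_zero (i := k) (by simpa using hk) (sub_self _), mul_zero]

/-- Nonnegative coefficients keep the function positive at the origin, which excludes a zero there. -/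
theorem IsFactored.pos {n : ℕ} {c a : ℕ → ℝ} (h : IsFactored n c a) (hc : ∀ k, 0 ≤ c k)
    (hc0 : 0 < c 0) {k : ℕ} (hk : k ∈ Icc 1 (n / 2)) (ha : 0 ≤ a k) : 0 < a k := by
  refine ha.lt_of_ne fun h0 => ?_
  have h1 := h (a k)
  rw [trigProd_apply_self hk, mul_zero, ← h0, expSum] at h1
  simp only [Complex.ofReal_zero, mul_zero, zero_mul, Complex.exp_zero, mul_one] at h1
  have h2 : ∑ k ∈ Finset.range (n + 1), c k = 0 := by exact_mod_cast h1
  have h3 := Finset.single_le_sum (f := c) (fun i _ => hc i)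
    (Finset.mem_range.mpr (Nat.succ_pos n))
  linarith

theorem IsFactored.zero_eq {n : ℕ} {t : ℝ} {a : ℕ → ℝ} (h : IsFactored n (isingCoeff n t) a)
    (ha : ∀ k, a k ∈ Icc 0 (Real.pi / 2)) (hmono : MonotoneOn a (Icc 1 (n / 2))) {k : ℕ}
    (hk : k ∈ Icc 1 (n / 2 + n % 2)) : zero n k t = if k ≤ n / 2 then a k else Real.pi / 2 := by
  rw [zero_eq_kthZero]
  exact h.kthZero_eq (isingCoeff_zero_pos n t).ne' (fun k hk =>
    ⟨h.pos (isingCoeff_nonneg n t) (isingCoeff_zero_pos n t) hk (ha k).1, (ha k).2⟩) hmono hk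

/-- `Z_{n,t}` factors through its positive zeros as computed by `zero`: the factorization over some
sorted real configuration identifies that configuration with the `zero n k t`. -/
theorem isFactored_zero {n : ℕ} (hn : 0 < n) {t : ℝ} (ht : 0 ≤ t) :
    IsFactored n (isingCoeff n t) (fun k => zero n k t) ∧
      (∀ k ∈ Icc 1 (n / 2), zero n k t ∈ Ioc 0 (Real.pi / 2)) ∧
      MonotoneOn (fun k => zero n k t) (Icc 1 (n / 2)) := by
  obtain ⟨a, -, ha, -, hmono, -, -, h, -⟩ := exists_ordered_factorizations hn ht le_rfl
  have hz : ∀ k ∈ Icc 1 (n / 2), zero n k t = a k := fun k hk => by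
    rw [h.zero_eq ha hmono ⟨hk.1, hk.2.trans (Nat.le_add_right _ _)⟩, if_pos hk.2]
  refine ⟨fun x => ?_, fun k hk => ?_, fun k hk l hl hkl => ?_⟩
  · rw [h x, trigProd_congr hz]
  · rw [hz k hk]
    exact ⟨h.pos (isingCoeff_nonneg n t) (isingCoeff_zero_pos n t) hk (ha k).1, (ha k).2⟩
  · simp only [hz k hk, hz l hl]
    exact hmono hk hl hkl

theorem zero_middle {n : ℕ} (hn : Odd n) {t : ℝ} (ht : 0 ≤ t) :
    zero n ((n + 1) / 2) t = Real.pi / 2 := by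
  obtain ⟨a, -, ha, -, hmono, -, -, h, -⟩ := exists_ordered_factorizations hn.pos ht le_rfl
  obtain ⟨m, rfl⟩ := hn
  rw [h.zero_eq ha hmono ⟨by lia, by lia⟩, if_neg (by lia)]

theorem zero_anti {n k : ℕ} (hk : k ∈ Icc 1 (n / 2)) {t t' : ℝ} (ht : 0 ≤ t) (htt' : t ≤ t') :
    zero n k t' ≤ zero n k t := by
  have hn : 0 < n := by
    have := hk.1.trans hk.2
    lia
  obtain ⟨a, a', ha, ha', hmono, hmono', hle, h, h'⟩ := exists_ordered_factorizations hn ht htt'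
  have hk' : k ∈ Icc 1 (n / 2 + n % 2) := ⟨hk.1, hk.2.trans (Nat.le_add_right _ _)⟩
  rw [h.zero_eq ha hmono hk', h'.zero_eq ha' hmono' hk', if_pos hk.2, if_pos hk.2]
  exact hle k

theorem zero_time_zero {n k : ℕ} (hk : k ∈ Icc 1 (n / 2)) : zero n k 0 = Real.pi / 2 := by
  have h : IsFactored n (isingCoeff n 0) (fun _ => Real.pi / 2) := by
    intro x
    have : isingCoeff n 0 = fun k => (n.choose k : ℝ) := by
      funext k
      simp [isingCoeff]
    rw [this, expSum_choose]
    simp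
  have hpi := Real.pi_pos
  rw [h.zero_eq (fun _ => right_mem_Icc.mpr (by positivity)) monotoneOn_const
    ⟨hk.1, hk.2.trans (Nat.le_add_right _ _)⟩, if_pos hk.2]

/-! ### Strict monotonicity -/

/-- If a combination of the functions `u ↦ e^{u (n - 2k)²}` vanishes on an interval, then it vanishes
identically, and as `u → -∞` the coefficients with the smallest exponent, `k = ⌊n/2⌋` and
`k = ⌈n/2⌉`, sum to zero. -/
theorem sum_eq_zero_of_exp_sum_eq_zero {n : ℕ} {d : ℕ → ℂ} {s s' : ℝ} (hs : s < s')
    (h : ∀ u ∈ Icc s s', ∑ k ∈ Finset.range (n + 1),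
      d k * (Real.exp (u * ((n : ℝ) - 2 * k) ^ 2) : ℝ) = 0) :
    ∑ k ∈ {n / 2, n / 2 + n % 2}, d k = 0 := by
  set g : ℝ → ℂ := fun u => ∑ k ∈ Finset.range (n + 1),
      d k * (Real.exp (u * ((n : ℝ) - 2 * k) ^ 2) : ℝ) with hg
  have hofReal (x : ℝ) : AnalyticAt ℝ (fun y : ℝ => (y : ℂ)) x := Complex.ofRealCLM.analyticAt x
  have hga : AnalyticOnNhd ℝ g univ := by
    intro u _
    refine Finset.analyticAt_fun_sum _ fun k _ => analyticAt_const.mul ?_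
    have h1 : AnalyticAt ℝ (fun u : ℝ => Real.exp (u * ((n : ℝ) - 2 * k) ^ 2)) u := by fun_prop
    exact (hofReal _).comp h1
  have hg0 : g = 0 := by
    refine hga.eq_of_eventuallyEq (z₀ := (s + s') / 2) (fun u _ => analyticAt_const) ?_
    filter_upwards [Icc_mem_nhds (a := s) (b := s') (x := (s + s') / 2) (by linarith)
      (by linarith)] with u hu
    exact h u hu
  have hn := congrArg (Nat.cast (R := ℝ)) (Nat.mod_add_div n 2)
  push_cast at hn
  set ε : ℝ := ((n % 2 : ℕ) : ℝ) with hε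
  have hε0 : 0 ≤ ε := Nat.cast_nonneg _
  have hε2 : ε ^ 2 = ε := by
    rcases Nat.mod_two_eq_zero_or_one n with hm | hm <;> simp [hε, hm]
  -- After division by `exp (ε u)`, only the terms with `(n - 2k)² = ε` survive as `u → -∞`.
  have hterm (k : ℕ) : Tendsto (fun u : ℝ => d k * (Real.exp (u * (((n : ℝ) - 2 * k) ^ 2 - ε)) : ℝ))
      atBot (𝓝 (if k ∈ ({n / 2, n / 2 + n % 2} : Finset ℕ) then d k else 0)) := by
    split_ifs with hk
    · have : ((n : ℝ) - 2 * k) ^ 2 - ε = 0 := by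
        rw [Finset.mem_insert, Finset.mem_singleton] at hk
        rcases hk with rfl | rfl
        · rw [← hn]
          linear_combination hε2
        · push_cast
          rw [← hn, ← hε]
          linear_combination hε2
      simp [this]
    · have hpos : 0 < ((n : ℝ) - 2 * k) ^ 2 - ε := by
        rw [Finset.mem_insert, Finset.mem_singleton, not_or] at hk
        rcases lt_or_ge k (n / 2) with hlt | hge
        · have : (k : ℝ) + 1 ≤ ((n / 2 : ℕ) : ℝ) := by exact_mod_cast hlt
          nlinarith
        · have : ((n / 2 : ℕ) : ℝ) + ((n % 2 : ℕ) : ℝ) + 1 ≤ k := by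
            have : n / 2 + n % 2 + 1 ≤ k := by
              rcases Nat.mod_two_eq_zero_or_one n with hm | hm <;> lia
            exact_mod_cast this
          rw [← hε] at this
          nlinarith
      have h1 : Tendsto (fun u : ℝ => Real.exp (u * (((n : ℝ) - 2 * k) ^ 2 - ε))) atBot (𝓝 0) :=
        Real.tendsto_exp_atBot.comp (tendsto_id.atBot_mul_const hpos)
      have h2 := ((Complex.continuous_ofReal.tendsto 0).comp h1).const_mul (d k)
      simpa using h2
  have hlim := tendsto_finsetSum (Finset.range (n + 1)) fun k _ => hterm k
  have hzero : (fun u : ℝ => ∑ k ∈ Finset.range (n + 1),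
      d k * (Real.exp (u * (((n : ℝ) - 2 * k) ^ 2 - ε)) : ℝ)) = fun _ => 0 := by
    funext u
    have h1 := congrFun hg0 u
    simp only [hg, Pi.zero_apply] at h1
    have h2 (k : ℕ) : d k * (Real.exp (u * (((n : ℝ) - 2 * k) ^ 2 - ε)) : ℝ) =
        (Real.exp (-(u * ε)) : ℝ) * (d k * (Real.exp (u * ((n : ℝ) - 2 * k) ^ 2) : ℝ)) := by
      rw [mul_left_comm, ← Complex.ofReal_mul, ← Real.exp_add]
      congr 3
      ring
    simp only [h2]
    rw [← Finset.mul_sum, h1, mul_zero]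
  rw [hzero, Finset.sum_ite_mem] at hlim
  have hsub : ({n / 2, n / 2 + n % 2} : Finset ℕ) ⊆ Finset.range (n + 1) := by
    intro k hk
    rw [Finset.mem_insert, Finset.mem_singleton] at hk
    rw [Finset.mem_range]
    lia
  rw [Finset.inter_eq_right.mpr hsub] at hlim
  exact (tendsto_nhds_unique hlim tendsto_const_nhds)

theorem hasDerivAt_expSum (n : ℕ) (c : ℕ → ℝ) (x : ℂ) : HasDerivAt (expSum n c)
    (∑ k ∈ Finset.range (n + 1), (c k : ℂ) *
      (Complex.exp (Complex.I * x * ((n : ℂ) - 2 * k)) * (Complex.I * ((n : ℂ) - 2 * k)))) x := by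
  refine HasDerivAt.fun_sum fun k _ => HasDerivAt.const_mul _ (HasDerivAt.cexp ?_)
  have := ((hasDerivAt_id x).const_mul Complex.I).mul_const ((n : ℂ) - 2 * k)
  simpa using this

/-- For odd `n`, a principal zero at `π/2` adds to the simple zero of `cos` there. -/
theorem hasDerivAt_trigProd_zero {n : ℕ} (hn : n % 2 = 1) {a : ℕ → ℝ} {k : ℕ}
    (hk : k ∈ Icc 1 (n / 2)) (ha : a k = Real.pi / 2) :
    HasDerivAt (trigProd n a) 0 ((Real.pi / 2 : ℝ) : ℂ) := by
  set p : ℂ := ((Real.pi / 2 : ℝ) : ℂ) with hp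
  set f : ℂ → ℂ := fun x => (2 * Complex.cos x) ^ (n % 2) with hf
  set g : ℂ → ℂ := fun x => ∏ k ∈ Finset.Icc 1 (n / 2),
    (2 * Complex.cos (2 * x) - 2 * Complex.cos (2 * (a k : ℂ))) with hgdef
  have hf0 : f p = 0 := by
    simp only [hf, hn, hp]
    push_cast
    simp
  have hg0 : g p = 0 := by
    refine Finset.prod_eq_zero (i := k) (by simpa using hk) ?_
    rw [ha, sub_self]
  have hfd : DifferentiableAt ℂ f p := by fun_prop
  have hgd : DifferentiableAt ℂ g p := by fun_prop
  have := hfd.hasDerivAt.mul hgd.hasDerivAt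
  rw [hf0, hg0, mul_zero, zero_mul, add_zero] at this
  exact this

/-- A zero that stays at `y` on a time interval forces `cos y = 0` for odd `n` and is impossible for even
`n`, by comparison of the slowest exponentials; the same comparison for the derivative excludes
`y = π/2` for odd `n`. -/
theorem zero_strictAnti {n k : ℕ} (hk : k ∈ Icc 1 (n / 2)) :
    StrictAntiOn (fun t : ℝ => zero n k t) (Ici 0) := by
  intro s hs s' hs' hss'
  have hn : 0 < n := by
    have := hk.1.trans hk.2
    lia
  refine (zero_anti hk hs hss'.le).lt_of_ne fun heq => ?_
  set y := zero n k s with hy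
  have hconst : ∀ u ∈ Icc s s', zero n k u = y := fun u hu =>
    le_antisymm (zero_anti hk hs hu.1)
      (heq.symm.le.trans (zero_anti hk (le_trans hs hu.1) hu.2))
  have h1 : ∀ u ∈ Icc s s', ∑ j ∈ Finset.range (n + 1),
      ((n.choose j : ℂ) * Complex.exp (Complex.I * y * ((n : ℂ) - 2 * j))) *
        (Real.exp (u * ((n : ℝ) - 2 * j) ^ 2) : ℝ) = 0 := by
    intro u hu
    have h2 := (isFactored_zero hn (le_trans hs hu.1)).1 (zero n k u)
    rw [trigProd_apply_self (a := fun k => zero n k u) hk, mul_zero, hconst u hu, expSum] at h2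
    rw [← h2]
    refine Finset.sum_congr rfl fun j _ => ?_
    rw [isingCoeff, Complex.ofReal_mul, Complex.ofReal_natCast]
    ring
  have h2 := sum_eq_zero_of_exp_sum_eq_zero hss' h1
  have hchoose : (n.choose (n / 2) : ℂ) ≠ 0 := by
    exact_mod_cast (Nat.choose_pos (Nat.div_le_self n 2)).ne'
  have hcast := congrArg (Nat.cast (R := ℂ)) (Nat.mod_add_div n 2)
  push_cast at hcast
  rcases Nat.mod_two_eq_zero_or_one n with hm | hm
  · rw [hm] at h2 hcast
    have h3 : (n : ℂ) - 2 * ((n / 2 : ℕ) : ℂ) = 0 := by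
      rw [← hcast]
      simp
    simp only [add_zero, Finset.pair_eq_singleton, Finset.sum_singleton, h3, mul_zero,
      Complex.exp_zero, mul_one] at h2
    exact hchoose h2
  · rw [hm] at hcast
    have hne : n / 2 ≠ n / 2 + 1 := by lia
    have e1 : (n : ℂ) - 2 * ((n / 2 : ℕ) : ℂ) = 1 := by
      rw [← hcast]
      push_cast
      ring
    have e2 : (n : ℂ) - 2 * ((n / 2 + 1 : ℕ) : ℂ) = -1 := by
      push_cast
      linear_combination e1
    have hsymm : n.choose (n / 2 + 1) = n.choose (n / 2) :=
      Nat.choose_symm_of_eq_add (by lia)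
    rw [hm, Finset.sum_pair hne, e1, e2, hsymm, ← mul_add] at h2
    have hcos : Complex.cos y = 0 := by
      have h3 := (mul_eq_zero.mp h2).resolve_left hchoose
      have h4 : 2 * Complex.cos y = 0 := by
        rw [Complex.two_cos, ← h3]
        congr 2 <;> ring
      exact (mul_eq_zero.mp h4).resolve_left two_ne_zero
    have hcos' : Real.cos y = 0 := by exact_mod_cast hcos
    have hyI := (isFactored_zero hn hs).2.1 k hk
    have hypi : y = Real.pi / 2 := by
      by_contra hne
      have := Real.cos_pos_of_mem_Ioo (x := y)
        ⟨by linarith [hyI.1, Real.pi_pos], lt_of_le_of_ne hyI.2 hne⟩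
      linarith
    -- `π/2` is then at least a triple zero, so that the derivative vanishes there as well.
    have h4 : ∀ u ∈ Icc s s', ∑ j ∈ Finset.range (n + 1),
        ((n.choose j : ℂ) * (Complex.exp (Complex.I * ((Real.pi / 2 : ℝ) : ℂ) * ((n : ℂ) - 2 * j)) *
          (Complex.I * ((n : ℂ) - 2 * j)))) *
          (Real.exp (u * ((n : ℝ) - 2 * j) ^ 2) : ℝ) = 0 := by
      intro u hu
      have h5 := (hasDerivAt_trigProd_zero hm (a := fun k => zero n k u) hk
        ((hconst u hu).trans hypi)).const_mul ((isingCoeff n u 0 : ℝ) : ℂ)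
      rw [mul_zero] at h5
      have h6 := hasDerivAt_expSum n (isingCoeff n u) ((Real.pi / 2 : ℝ) : ℂ)
      rw [show expSum n (isingCoeff n u) = fun x => ((isingCoeff n u 0 : ℝ) : ℂ) *
        trigProd n (fun k => zero n k u) x from
          funext (isFactored_zero hn (le_trans hs hu.1)).1] at h6
      rw [← h6.unique h5]
      refine Finset.sum_congr rfl fun j _ => ?_
      rw [isingCoeff, Complex.ofReal_mul, Complex.ofReal_natCast]
      ring
    have h5 := sum_eq_zero_of_exp_sum_eq_zero hss' h4
    rw [hm, Finset.sum_pair hne, e1, e2, hsymm, ← mul_add] at h5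
    have h6 := (mul_eq_zero.mp h5).resolve_left hchoose
    have e3 : Complex.exp (Complex.I * ((Real.pi / 2 : ℝ) : ℂ) * 1) = Complex.I := by
      rw [show Complex.I * ((Real.pi / 2 : ℝ) : ℂ) * 1 = Real.pi / 2 * Complex.I by
        push_cast; ring, Complex.exp_pi_div_two_mul_I]
    have e4 : Complex.exp (Complex.I * ((Real.pi / 2 : ℝ) : ℂ) * -1) = -Complex.I := by
      rw [mul_neg, Complex.exp_neg, e3, Complex.inv_I]
    rw [e3, e4] at h6
    have : (-2 : ℂ) = 0 := by
      rw [← h6]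
      linear_combination (-2 : ℂ) * Complex.I_sq
    norm_num at this

/-! ### The limit of large times -/

theorem IsFactored.const_mul {n : ℕ} {c a : ℕ → ℝ} (h : IsFactored n c a) (L : ℝ) :
    IsFactored n (fun k => L * c k) a := by
  intro x
  have := h x
  simp only [expSum, Complex.ofReal_mul, mul_assoc] at this ⊢
  rw [← Finset.mul_sum, this]

/-- The coefficients of `2 cos (n x)`, the limit of `e^{-tn²} Z_{n,t}` as `t → ∞`. -/
def endpointCoeff (n k : ℕ) : ℝ := if k = 0 ∨ k = n then 1 else 0

theorem expSum_endpointCoeff {n : ℕ} (hn : 0 < n) (x : ℂ) :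
    expSum n (endpointCoeff n) x = 2 * Complex.cos (n * x) := by
  have h0 : (0 : ℕ) ≠ n := hn.ne
  have hsub : ({0, n} : Finset ℕ) ⊆ Finset.range (n + 1) := by
    intro k hk
    rw [Finset.mem_insert, Finset.mem_singleton] at hk
    rw [Finset.mem_range]
    lia
  rw [expSum, ← Finset.sum_subset hsub, Finset.sum_pair h0]
  · simp only [endpointCoeff, true_or, or_true, if_true]
    rw [Complex.two_cos]
    push_cast
    rw [one_mul, one_mul]
    congr 2 <;> ring
  · intro k _ hk
    rw [Finset.mem_insert, Finset.mem_singleton] at hk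
    simp [endpointCoeff, hk]

theorem isFactored_endpointCoeff {n : ℕ} (hn : 0 < n) :
    IsFactored n (endpointCoeff n) (fun k => (2 * (k : ℝ) - 1) * Real.pi / (2 * n)) ∧
      (∀ k ∈ Icc 1 (n / 2),
        (2 * (k : ℝ) - 1) * Real.pi / (2 * n) ∈ Ioo 0 (Real.pi / 2)) ∧
      StrictMonoOn (fun k : ℕ => (2 * (k : ℝ) - 1) * Real.pi / (2 * n)) (Icc 1 (n / 2)) := by
  have hn' : (0 : ℝ) < n := by exact_mod_cast hn
  have hpi := Real.pi_pos
  have hmem : ∀ k ∈ Icc 1 (n / 2),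
      (2 * (k : ℝ) - 1) * Real.pi / (2 * n) ∈ Ioo 0 (Real.pi / 2) := by
    intro k hk
    have h1 : (1 : ℝ) ≤ k := by exact_mod_cast hk.1
    have h2 : 2 * (k : ℝ) ≤ n := by
      have : 2 * k ≤ n := by have := hk.2; lia
      exact_mod_cast this
    constructor
    · exact div_pos (mul_pos (by linarith) hpi) (by positivity)
    · rw [div_lt_div_iff₀ (by positivity) two_pos]
      nlinarith
  have hmono : StrictMonoOn (fun k : ℕ => (2 * (k : ℝ) - 1) * Real.pi / (2 * n))
      (Icc 1 (n / 2)) := by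
    intro k _ l _ hkl
    have : (k : ℝ) < l := by exact_mod_cast hkl
    simp only
    gcongr
  have hcosk (k : ℕ) :
      Complex.cos (n * (((2 * (k : ℝ) - 1) * Real.pi / (2 * n) : ℝ) : ℂ)) = 0 := by
    rw [Complex.cos_eq_zero_iff]
    refine ⟨(k : ℤ) - 1, ?_⟩
    have : (n : ℂ) ≠ 0 := by exact_mod_cast hn.ne'
    push_cast
    field_simp
    ring
  refine ⟨fun x => expSum_eq_trigProd hmem hmono (fun k _ => ?_) (fun k _ => ?_) (fun hodd => ?_) x,
    hmem, hmono⟩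
  · rw [expSum_endpointCoeff hn, hcosk, mul_zero]
  · rw [expSum_endpointCoeff hn, mul_neg, Complex.cos_neg, hcosk, mul_zero]
  · rw [expSum_endpointCoeff hn, mul_eq_zero, Complex.cos_eq_zero_iff]
    right
    refine ⟨((n / 2 : ℕ) : ℤ), ?_⟩
    have hcast := congrArg (Nat.cast (R := ℂ)) (Nat.mod_add_div n 2)
    rw [hodd] at hcast
    push_cast at hcast
    rw [Int.cast_natCast]
    push_cast
    linear_combination (-(Real.pi : ℂ) / 2) * hcast

theorem tendsto_scaled_isingCoeff {n : ℕ} (k : ℕ) :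
    Tendsto (fun t : ℝ => Real.exp (-(t * n ^ 2)) * isingCoeff n t k) atTop
      (𝓝 (endpointCoeff n k)) := by
  have h (t : ℝ) : Real.exp (-(t * n ^ 2)) * isingCoeff n t k =
      n.choose k * Real.exp (-(t * (4 * k * (n - k)))) := by
    rw [isingCoeff, mul_left_comm, ← Real.exp_add]
    congr 2
    ring
  simp only [h, endpointCoeff]
  split_ifs with hk
  · rcases hk with rfl | rfl <;> simp
  · rw [not_or] at hk
    rcases lt_or_ge n k with hlt | hge
    · simp [Nat.choose_eq_zero_of_lt hlt]
    · have h1 : (0 : ℝ) < k := by exact_mod_cast Nat.pos_of_ne_zero hk.1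
      have h2 : (k : ℝ) < n := by exact_mod_cast lt_of_le_of_ne hge hk.2
      have h3 : 0 < 4 * (k : ℝ) * (n - k) := mul_pos (by linarith) (by linarith)
      have h4 := (Real.tendsto_exp_neg_atTop_nhds_zero.comp
        (tendsto_id.atTop_mul_const h3)).const_mul (n.choose k : ℝ)
      rw [mul_zero] at h4
      exact h4

/-- The limits of the zeros exist by monotonicity, and are the principal zeros of `2 cos (n x)`, which
are unique. -/
theorem tendsto_zero_atTop {n k : ℕ} (hk : k ∈ Icc 1 (n / 2)) :
    Tendsto (fun t : ℝ => zero n k t) atTop (𝓝 ((2 * (k : ℝ) - 1) * Real.pi / (2 * (n : ℝ)))) := by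
  have hn : 0 < n := by
    have := hk.1.trans hk.2
    lia
  have hpi := Real.pi_pos
  have hlim : ∀ j, ∃ y, j ∈ Icc 1 (n / 2) → Tendsto (fun t : ℝ => zero n j t) atTop (𝓝 y) := by
    intro j
    by_cases hj : j ∈ Icc 1 (n / 2)
    · have hanti : Antitone fun t : ℝ => zero n j (max t 0) := fun s s' hss' =>
        zero_anti hj (le_max_right _ _) (max_le_max_right _ hss')
      have hbdd : BddBelow (range fun t : ℝ => zero n j (max t 0)) :=
        ⟨0, by rintro _ ⟨t, rfl⟩; exact ((isFactored_zero hn (le_max_right t 0)).2.1 j hj).1.le⟩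
      refine ⟨_, fun _ => (tendsto_atTop_ciInf hanti hbdd).congr' ?_⟩
      filter_upwards [eventually_ge_atTop 0] with t ht
      rw [max_eq_left ht]
    · exact ⟨0, fun h => absurd h hj⟩
  choose y hy using hlim
  have hyN {j : ℕ} (hj : j ∈ Icc 1 (n / 2)) : Tendsto (fun i : ℕ => zero n j i) atTop (𝓝 (y j)) :=
    (hy j hj).comp tendsto_natCast_atTop_atTop
  have hfac : IsFactored n (endpointCoeff n) y := by
    refine IsFactored.of_tendsto
      (cs := fun i j => Real.exp (-((i : ℝ) * n ^ 2)) * isingCoeff n i j)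
      (as := fun i j => if j ∈ Icc 1 (n / 2) then zero n j i else y j) (fun i => ?_)
      (fun j => (tendsto_scaled_isingCoeff j).comp tendsto_natCast_atTop_atTop) ?_
    · refine fun x => (((isFactored_zero hn (Nat.cast_nonneg i)).1.const_mul _) x).trans ?_
      congr 1
      exact trigProd_congr (fun j hj => (if_pos hj).symm) x
    · refine tendsto_pi_nhds.mpr fun j => ?_
      by_cases hj : j ∈ Icc 1 (n / 2)
      · simpa only [if_pos hj] using hyN hj
      · simpa only [if_neg hj] using tendsto_const_nhds
  have hend : (0 : ℝ) < endpointCoeff n 0 := by simp [endpointCoeff]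
  have hend' (j : ℕ) : 0 ≤ endpointCoeff n j := by
    unfold endpointCoeff
    split_ifs <;> norm_num
  have hymem : ∀ j ∈ Icc 1 (n / 2), y j ∈ Icc 0 (Real.pi / 2) := fun j hj =>
    isClosed_Icc.mem_of_tendsto (hyN hj) (Eventually.of_forall fun i =>
      Ioc_subset_Icc_self ((isFactored_zero hn (Nat.cast_nonneg i)).2.1 j hj))
  have hymono : MonotoneOn y (Icc 1 (n / 2)) := fun i hi j hj hij =>
    le_of_tendsto_of_tendsto' (hyN hi) (hyN hj) fun l =>
      (isFactored_zero hn (Nat.cast_nonneg l)).2.2 hi hj hij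
  obtain ⟨hfac', hmem', hmono'⟩ := isFactored_endpointCoeff hn
  have hk' : k ∈ Icc 1 (n / 2 + n % 2) := ⟨hk.1, hk.2.trans (Nat.le_add_right _ _)⟩
  have h1 := hfac.kthZero_eq hend.ne' (fun j hj =>
    ⟨hfac.pos hend' hend hj (hymem j hj).1, (hymem j hj).2⟩) hymono hk'
  have h2 := hfac'.kthZero_eq hend.ne' (fun j hj => Ioo_subset_Ioc_self (hmem' j hj))
    hmono'.monotoneOn hk'
  rw [if_pos hk.2] at h1 h2
  rw [← h2, h1]
  exact hy k hk

end CurieWeiss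

theorem theorem2 (n : ℕ) (hn : 0 < n) :
    (∀ t : ℝ, 0 ≤ t →
      CurieWeiss.ArePrincipalZeros n t (fun k => CurieWeiss.zero n k t)) ∧
    (∀ k : ℕ, 1 ≤ k → k ≤ n / 2 →
      StrictAntiOn (fun t : ℝ => CurieWeiss.zero n k t) (Ici 0) ∧
      CurieWeiss.zero n k 0 = Real.pi / 2 ∧
      Tendsto (fun t : ℝ => CurieWeiss.zero n k t) atTop
        (𝓝 ((2 * (k : ℝ) - 1) * Real.pi / (2 * (n : ℝ))))) ∧
    (Odd n → ∀ t : ℝ, 0 ≤ t → CurieWeiss.zero n ((n + 1) / 2) t = Real.pi / 2) := by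
  refine ⟨fun t ht => ?_, fun k hk hk' => ?_, fun hodd t ht => CurieWeiss.zero_middle hodd ht⟩
  · obtain ⟨hfac, hmem, hmono⟩ := CurieWeiss.isFactored_zero hn ht
    refine ⟨hmem, hmono, fun w => ?_⟩
    rw [CurieWeiss.partitionFunction_eq_expSum]
    exact hfac.analyticOrderAt_eq (CurieWeiss.isingCoeff_zero_pos n t).ne' w
  · exact ⟨CurieWeiss.zero_strictAnti ⟨hk, hk'⟩, CurieWeiss.zero_time_zero ⟨hk, hk'⟩,
      CurieWeiss.tendsto_zero_atTop ⟨hk, hk'⟩⟩
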